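/- A quantaloid is a category enriched in the category $\mathsf{Sup}$ of complete lattices and supremum-preserving maps; it is small if its objects form a set. A homomorphism of quantaloids is a functor preserving all suprema of arrows; for quantaloids $\mathcal C,\mathcal D$, the homomorphisms $\mathcal C\to\mathcal D$ and the natural transformations between them, ordered componentwise, form a quantaloid $\mathsf{QUANT}(\mathcal C,\mathcal D)$. An equivalence $\mathcal C\simeq\mathcal D$ of quantaloids is a pair of homomorphisms, mutually inverse up to natural isomorphism. For a small quantaloid $\mathcal Q$ let: - $\mathsf{Mod}(\mathcal Q)=\mathsf{QUANT}(\mathcal Q^{\mathrm{op}},\mathsf{Sup})$, the quantaloid of $\mathcal Q$-modules; - $\mathsf{Idm}(\mathcal Q)$ be the split-idempotent completion of $\mathcal Q$: the objects are the idempotents of $\mathcal Q$, an arrow from $e\colon A\to A$ to $f\colon B\to B$ is an arrow $b\colon A\to B$ with $b\circ e=b=f\circ b$, and composition and local order are those of $\mathcal Q$; - $\mathsf{Ord}(\mathcal Q)=\mathsf{Cat}_{\mathsf{cc}}(\mathsf{Idm}(\mathcal Q))$ be the locally (pre)ordered 2-category of Cauchy complete $\mathsf{Idm}(\mathcal Q)$-enriched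 categories (those into which every left adjoint distributor is represented by a functor) and functors, where $F\le G\colon\mathbb A\to\mathbb B$ means $1_{ta}\le\mathbb B(Fa,Ga)$ for every object $a$ of $\mathbb A$, with $ta$ the type of $a$; - $\mathcal Z(\mathcal Q)=\mathsf{QUANT}(\mathcal Q,\mathcal Q)(\mathrm{Id}_{\mathcal Q},\mathrm{Id}_{\mathcal Q})$ be the centre of $\mathcal Q$, a commutative quantale under composition and the componentwise order. **Proposition.** Let $\mathcal Q$ and $\mathcal Q'$ be small quantaloids. 1. If $\mathcal Q\simeq\mathcal Q'$ as quantaloids, then $\mathsf{Ord}(\mathcal Q)$ and $\mathsf{Ord}(\mathcal Q')$ are biequivalent. 2. If $\mathsf{Ord}(\mathcal Q)$ and $\mathsf{Ord}(\mathcal Q')$ are biequivalent, then $\mathsf{Mod}(\mathcal Q)\simeq\mathsf{Mod}(\mathcal Q')$ as quantaloids. 3. If $\mathsf{Mod}(\mathcal Q)\simeq\mathsf{Mod}(\mathcal Q')$ as quantaloids, then $\mathcal Z(\mathcal Q)\cong\mathcal Z(\mathcal Q')$ as quantales. -/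

import Mathlib

open CategoryTheory

universe u

namespace QOrd

universe w v v₁ u₁ v₂ u₂

/-! ### Quantaloids and their homomorphisms -/

/-- A quantaloid: a category enriched in complete lattices and supremum-preserving maps, i.e. every
hom-set is a complete lattice and composition preserves arbitrary suprema in each variable. -/
class Quantaloid (C : Type u) [Category.{v} C] where
  homLattice : ∀ X Y : C, CompleteLattice (X ⟶ Y)
  sSup_comp : ∀ {X Y Z : C} (S : Set (X ⟶ Y)) (g : Y ⟶ Z),
    sSup S ≫ g = sSup ((fun f : X ⟶ Y => f ≫ g) '' S)
  comp_sSup : ∀ {X Y Z : C} (f : X ⟶ Y) (S : Set (Y ⟶ Z)),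
    f ≫ sSup S = sSup ((fun g : Y ⟶ Z => f ≫ g) '' S)

attribute [reducible, instance] Quantaloid.homLattice

namespace Quantaloid

variable {C : Type u} [Category.{v} C] [Quantaloid C]

theorem sup_comp {X Y Z : C} (f f' : X ⟶ Y) (g : Y ⟶ Z) :
    (f ⊔ f') ≫ g = (f ≫ g) ⊔ (f' ≫ g) := by
  have h := sSup_comp {f, f'} g
  rwa [Set.image_pair, sSup_pair, sSup_pair] at h

theorem comp_sup {X Y Z : C} (f : X ⟶ Y) (g g' : Y ⟶ Z) :
    f ≫ (g ⊔ g') = (f ≫ g) ⊔ (f ≫ g') := by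
  have h := comp_sSup f {g, g'}
  rwa [Set.image_pair, sSup_pair, sSup_pair] at h

theorem comp_mono {X Y Z : C} {f f' : X ⟶ Y} {g g' : Y ⟶ Z} (hf : f ≤ f') (hg : g ≤ g') :
    f ≫ g ≤ f' ≫ g' := by
  have h₁ : f ≫ g ≤ f' ≫ g := by
    have h := sup_comp f f' g
    rw [sup_eq_right.2 hf] at h
    rw [h]
    exact le_sup_left
  have h₂ : f' ≫ g ≤ f' ≫ g' := by
    have h := comp_sup f' g g'
    rw [sup_eq_right.2 hg] at h
    rw [h]
    exact le_sup_left
  exact h₁.trans h₂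

/-- The opposite quantaloid: arrows are reversed, the local order is unchanged. -/
instance instOpposite : Quantaloid Cᵒᵖ where
  homLattice X Y :=
    letI : PartialOrder (X ⟶ Y) := PartialOrder.lift (fun f => f.unop) (fun _ _ h => Quiver.Hom.unop_inj h)
    letI : SupSet (X ⟶ Y) := ⟨fun S => (sSup ((fun f : X ⟶ Y => f.unop) '' S)).op⟩
    completeLatticeOfSup (X ⟶ Y) (fun S =>
      ⟨fun f hf => le_sSup (α := Y.unop ⟶ X.unop) ⟨f, hf, rfl⟩,
       fun g hg => sSup_le (α := Y.unop ⟶ X.unop) (by rintro _ ⟨f, hf, rfl⟩; exact hg hf)⟩)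
  sSup_comp S g := Quiver.Hom.unop_inj (by
    refine (comp_sSup g.unop _).trans ?_
    change sSup _ = sSup _
    rw [Set.image_image, Set.image_image]
    rfl)
  comp_sSup f S := Quiver.Hom.unop_inj (by
    refine (sSup_comp _ f.unop).trans ?_
    change sSup _ = sSup _
    rw [Set.image_image, Set.image_image]
    rfl)

/-- The split-idempotent completion of a quantaloid. Objects are the idempotents `e : A ⟶ A`,
and arrows `e ⟶ f` are the arrows `b : A ⟶ B` with `e ≫ b = b = b ≫ f`, with the local order of
the given quantaloid. -/
instance instKaroubi : Quantaloid (Idempotents.Karoubi C) where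
  homLattice P Q :=
    letI : PartialOrder (P ⟶ Q) :=
      PartialOrder.lift (fun b => b.f) (fun _ _ h => Idempotents.Karoubi.Hom.ext h)
    letI : SupSet (P ⟶ Q) := ⟨fun S => ⟨sSup ((fun b : P ⟶ Q => b.f) '' S), by
      rw [sSup_comp, comp_sSup, Set.image_image, Set.image_image]
      congr 1
      exact Set.image_congr (fun b _ => b.comm)⟩⟩
    completeLatticeOfSup (P ⟶ Q) (fun S =>
      ⟨fun b hb => le_sSup (α := P.X ⟶ Q.X) ⟨b, hb, rfl⟩,
       fun g hg => sSup_le (α := P.X ⟶ Q.X) (by rintro _ ⟨b, hb, rfl⟩; exact hg hb)⟩)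
  sSup_comp S g := Idempotents.Karoubi.Hom.ext (by
    refine (sSup_comp _ g.f).trans ?_
    change sSup _ = sSup _
    rw [Set.image_image, Set.image_image]
    rfl)
  comp_sSup f S := Idempotents.Karoubi.Hom.ext (by
    refine (comp_sSup f.f _).trans ?_
    change sSup _ = sSup _
    rw [Set.image_image, Set.image_image]
    rfl)

end Quantaloid

/-- The split-idempotent completion `Idm(Q)` of a quantaloid `Q`. -/
abbrev Idm (C : Type u) [Category.{v} C] : Type (max u v) := Idempotents.Karoubi C

/-- A functor between quantaloids preserving suprema of arrows. -/
def PreservesSups {C : Type u₁} [Category.{v₁} C] [Quantaloid C]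
    {D : Type u₂} [Category.{v₂} D] [Quantaloid D] (F : C ⥤ D) : Prop :=
  ∀ {X Y : C} (S : Set (X ⟶ Y)), F.map (sSup S) = sSup ((fun f : X ⟶ Y => F.map f) '' S)

/-- A homomorphism of quantaloids. -/
structure QHom (C : Type u₁) [Category.{v₁} C] [Quantaloid C]
    (D : Type u₂) [Category.{v₂} D] [Quantaloid D] extends C ⥤ D where
  preservesSups : PreservesSups toFunctor

namespace QHom

/-- The identity homomorphism. -/
def id (C : Type u) [Category.{v} C] [Quantaloid C] : QHom C C where
  toFunctor := 𝟭 C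
  preservesSups S := by simp

variable {C : Type u₁} [Category.{v₁} C] [Quantaloid C]
  {D : Type u₂} [Category.{v₂} D] [Quantaloid D]

/-- Homomorphisms `C ⟶ D` and natural transformations form a category. -/
instance instCategory : Category.{max u₁ v₂} (QHom C D) where
  Hom F G := F.toFunctor ⟶ G.toFunctor
  id F := 𝟙 F.toFunctor
  comp α β := NatTrans.vcomp α β
  id_comp α := Category.id_comp (obj := C ⥤ D) α
  comp_id α := Category.comp_id (obj := C ⥤ D) α
  assoc α β γ := Category.assoc (obj := C ⥤ D) α β γ

/-- The component of a natural transformation at an object. -/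
abbrev app {F G : QHom C D} (α : F ⟶ G) (X : C) : F.obj X ⟶ G.obj X := NatTrans.app α X

theorem hom_ext {F G : QHom C D} {α β : F ⟶ G} (h : ∀ X, app α X = app β X) : α = β :=
  NatTrans.ext (funext h)

/-- Homomorphisms `C ⟶ D` and natural transformations form a quantaloid `QUANT(C, D)`,
with the componentwise order. -/
instance instQuantaloid : Quantaloid (QHom C D) where
  homLattice F G :=
    letI : PartialOrder (F ⟶ G) :=
      PartialOrder.lift (fun (α : F ⟶ G) (X : C) => app α X) (fun _ _ h => hom_ext (congrFun h))
    letI : SupSet (F ⟶ G) := ⟨fun S =>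
      { app := fun X => sSup ((fun α : F ⟶ G => app α X) '' S)
        naturality := fun X Y f => by
          rw [Quantaloid.comp_sSup, Quantaloid.sSup_comp, Set.image_image, Set.image_image]
          congr 1
          exact Set.image_congr (fun α _ => NatTrans.naturality α f) }⟩
    completeLatticeOfSup (F ⟶ G) (fun S =>
      ⟨fun α hα X => le_sSup ⟨α, hα, rfl⟩,
       fun β hβ X => sSup_le (by rintro _ ⟨α, hα, rfl⟩; exact hβ hα X)⟩)
  sSup_comp S β := hom_ext (fun X => by
    refine (Quantaloid.sSup_comp _ (app β X)).trans ?_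
    change sSup _ = sSup _
    rw [Set.image_image, Set.image_image]
    rfl)
  comp_sSup α S := hom_ext (fun X => by
    refine (Quantaloid.comp_sSup (app α X) _).trans ?_
    change sSup _ = sSup _
    rw [Set.image_image, Set.image_image]
    rfl)

end QHom

/-- An equivalence of quantaloids: homomorphisms in both directions, mutually inverse up to
natural isomorphism. -/
structure QEquiv (C : Type u₁) [Category.{v₁} C] [Quantaloid C]
    (D : Type u₂) [Category.{v₂} D] [Quantaloid D] where
  functor : QHom C D
  inverse : QHom D C
  unitIso : 𝟭 C ≅ functor.toFunctor ⋙ inverse.toFunctor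
  counitIso : inverse.toFunctor ⋙ functor.toFunctor ≅ 𝟭 D

/-! ### Suplattices and modules -/

/-- The type of complete lattices, regarded as suplattices. -/
structure SupLat where
  carrier : Type w
  [str : CompleteLattice carrier]

namespace SupLat

attribute [instance] SupLat.str

/-- Suplattices and supremum-preserving maps. -/
instance instCategory : Category.{w} SupLat.{w} where
  Hom L M := sSupHom L.carrier M.carrier
  id L := sSupHom.id L.carrier
  comp f g := sSupHom.comp g f

/-- The underlying map of an arrow of suplattices. -/
abbrev fn {L M : SupLat.{w}} (f : L ⟶ M) : sSupHom L.carrier M.carrier := f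

theorem hom_ext {L M : SupLat.{w}} {f g : L ⟶ M} (h : ∀ x, fn f x = fn g x) : f = g :=
  sSupHom.ext h

/-- Suplattices form a quantaloid for the pointwise order. -/
instance instQuantaloid : Quantaloid SupLat.{w} where
  homLattice L M :=
    letI : PartialOrder (L ⟶ M) :=
      PartialOrder.lift (fun (f : L ⟶ M) (x : L.carrier) => fn f x)
        (fun _ _ h => hom_ext (congrFun h))
    letI : SupSet (L ⟶ M) := ⟨fun S =>
      { toFun := fun x => ⨆ f ∈ S, fn f x
        map_sSup' := fun T => by
          simp only [map_sSup, sSup_image]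
          refine le_antisymm ?_ ?_
          · exact iSup₂_le fun f hf => iSup₂_le fun x hx =>
              le_iSup₂_of_le x hx (le_iSup₂_of_le f hf le_rfl)
          · exact iSup₂_le fun x hx => iSup₂_le fun f hf =>
              le_iSup₂_of_le f hf (le_iSup₂_of_le x hx le_rfl) }⟩
    completeLatticeOfSup (L ⟶ M) (fun S =>
      ⟨fun f hf x => le_iSup₂_of_le (f := fun (f : L ⟶ M) (_ : f ∈ S) => fn f x) f hf le_rfl,
       fun g hg x => iSup₂_le fun f hf => hg hf x⟩)
  sSup_comp S g := hom_ext (fun x => by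
    change fn g (⨆ f ∈ S, fn f x) = ⨆ h ∈ _, fn h x
    rw [iSup_image, map_iSup₂]
    rfl)
  comp_sSup f S := hom_ext (fun x => by
    change ⨆ g ∈ S, fn g (fn f x) = ⨆ h ∈ _, fn h x
    rw [iSup_image]
    rfl)

end SupLat

/-- The (large) quantaloid `Mod(Q) = QUANT(Qᵒᵖ, Sup)` of modules on a small quantaloid `Q`. -/
abbrev Mod (Q : Type u) [SmallCategory Q] [Quantaloid Q] : Type (u + 1) := QHom Qᵒᵖ SupLat.{u}

/-! ### Categories enriched in a quantaloid -/

/-- A category enriched in a quantaloid `R`. The set of objects together with its type function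
to the objects of `R` is given by the fibres of the type function: `A.obj X` is the set of objects
of `A` of type `X`. For `a'` of type `X'` and `a` of type `X`, `A.hom a' a : X ⟶ X'` is the
hom-arrow `A(a', a)`. -/
structure QCat (R : Type u) [SmallCategory R] [Quantaloid R] where
  obj : R → Type u
  hom : ∀ {X' X : R}, obj X' → obj X → (X ⟶ X')
  comp_le : ∀ {X'' X' X : R} (a'' : obj X'') (a' : obj X') (a : obj X),
    hom a' a ≫ hom a'' a' ≤ hom a'' a
  id_le : ∀ {X : R} (a : obj X), 𝟙 X ≤ hom a a

/-- A functor between enriched categories: a type-preserving map on objects such that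
`A(a', a) ≤ B(F a', F a)`. -/
@[ext]
structure QFunctor {R : Type u} [SmallCategory R] [Quantaloid R] (A B : QCat R) where
  map : ∀ {X : R}, A.obj X → B.obj X
  hom_le : ∀ {X' X : R} (a' : A.obj X') (a : A.obj X), A.hom a' a ≤ B.hom (map a') (map a)

namespace QFunctor

variable {R : Type u} [SmallCategory R] [Quantaloid R]

/-- The identity functor. -/
def id (A : QCat R) : QFunctor A A where
  map a := a
  hom_le _ _ := le_rfl

/-- Composition of functors (in diagrammatic order). -/
def comp {A B C : QCat R} (F : QFunctor A B) (G : QFunctor B C) : QFunctor A C where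
  map a := G.map (F.map a)
  hom_le a' a := (F.hom_le a' a).trans (G.hom_le _ _)

/-- `F ≤ G` when `1 ≤ B(F a, G a)` for every object `a`. -/
instance instPreorder (A B : QCat R) : Preorder (QFunctor A B) where
  le F G := ∀ (X : R) (a : A.obj X), 𝟙 X ≤ B.hom (F.map a) (G.map a)
  le_refl F _ a := B.id_le (F.map a)
  le_trans F G H h₁ h₂ X a := by
    have h := Quantaloid.comp_mono (h₂ X a) (h₁ X a)
    rw [Category.comp_id] at h
    exact h.trans (B.comp_le _ _ _)

theorem comp_mono {A B C : QCat R} {F F' : QFunctor A B} {G G' : QFunctor B C}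
    (hF : F ≤ F') (hG : G ≤ G') : F.comp G ≤ F'.comp G' := fun X a => by
  have h := Quantaloid.comp_mono (hG X (F'.map a)) ((hF X a).trans (G.hom_le _ _))
  rw [Category.comp_id] at h
  exact h.trans (C.comp_le _ _ _)

end QFunctor

/-- A distributor `Φ : A ⇸ B`, with elements `Φ(b, a) : ta ⟶ tb`. -/
@[ext]
structure Distributor {R : Type u} [SmallCategory R] [Quantaloid R] (A B : QCat R) where
  app : ∀ {Y X : R}, B.obj Y → A.obj X → (X ⟶ Y)
  comp_left_le : ∀ {Y Y' X : R} (b : B.obj Y) (b' : B.obj Y') (a : A.obj X),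
    app b' a ≫ B.hom b b' ≤ app b a
  comp_right_le : ∀ {Y X' X : R} (b : B.obj Y) (a' : A.obj X') (a : A.obj X),
    A.hom a' a ≫ app b a' ≤ app b a

namespace Distributor

variable {R : Type u} [SmallCategory R] [Quantaloid R]

/-- Elementwise order of distributors. -/
instance instPartialOrder (A B : QCat R) : PartialOrder (Distributor A B) where
  le Φ Ψ := ∀ (Y X : R) (b : B.obj Y) (a : A.obj X), Φ.app b a ≤ Ψ.app b a
  le_refl Φ _ _ _ _ := le_rfl
  le_trans Φ Ψ Θ h₁ h₂ Y X b a := (h₁ Y X b a).trans (h₂ Y X b a)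
  le_antisymm Φ Ψ h₁ h₂ := by
    ext Y X b a
    exact le_antisymm (h₁ Y X b a) (h₂ Y X b a)

/-- The identity distributor on `A`, with elements `A(a', a)`. -/
def id (A : QCat R) : Distributor A A where
  app a' a := A.hom a' a
  comp_left_le b b' a := A.comp_le b b' a
  comp_right_le b a' a := A.comp_le b a' a

/-- The composite `Ψ ⊗ Φ : A ⇸ C` of `Φ : A ⇸ B` and `Ψ : B ⇸ C`, with elements
`(Ψ ⊗ Φ)(c, a) = ⋁ b, Ψ(c, b) ∘ Φ(b, a)`. -/
def tensor {A B C : QCat R} (Ψ : Distributor B C) (Φ : Distributor A B) : Distributor A C where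
  app c a := sSup {f | ∃ (Y : R) (b : B.obj Y), f = Φ.app b a ≫ Ψ.app c b}
  comp_left_le c c' a := by
    rw [Quantaloid.sSup_comp]
    refine sSup_le ?_
    rintro _ ⟨_, ⟨Y, b, rfl⟩, rfl⟩
    refine le_trans ?_ (le_sSup ⟨Y, b, rfl⟩)
    change (Φ.app b a ≫ Ψ.app c' b) ≫ C.hom c c' ≤ _
    rw [Category.assoc]
    exact Quantaloid.comp_mono le_rfl (Ψ.comp_left_le c c' b)
  comp_right_le c a' a := by
    rw [Quantaloid.comp_sSup]
    refine sSup_le ?_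
    rintro _ ⟨_, ⟨Y, b, rfl⟩, rfl⟩
    refine le_trans ?_ (le_sSup ⟨Y, b, rfl⟩)
    change A.hom a' a ≫ Φ.app b a' ≫ Ψ.app c b ≤ _
    rw [← Category.assoc]
    exact Quantaloid.comp_mono (Φ.comp_right_le b a' a) le_rfl

/-- `Φ` is left adjoint to `Ψ` in the 2-category of distributors. -/
def Adjoint {A B : QCat R} (Φ : Distributor A B) (Ψ : Distributor B A) : Prop :=
  id A ≤ tensor Ψ Φ ∧ tensor Φ Ψ ≤ id B

/-- `Φ` is a left adjoint distributor, also called a Cauchy distributor. -/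
def IsCauchy {A B : QCat R} (Φ : Distributor A B) : Prop :=
  ∃ Ψ : Distributor B A, Adjoint Φ Ψ

/-- The distributor `B(-, F-) : A ⇸ B` represented by a functor `F : A ⟶ B`. -/
def ofFunctor {A B : QCat R} (F : QFunctor A B) : Distributor A B where
  app b a := B.hom b (F.map a)
  comp_left_le b b' a := B.comp_le b b' (F.map a)
  comp_right_le b a' a :=
    (Quantaloid.comp_mono (F.hom_le a' a) le_rfl).trans (B.comp_le b (F.map a') (F.map a))

end Distributor

/-- An enriched category `C` is Cauchy complete when every left adjoint distributor into `C` is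
represented by a functor. -/
def CauchyComplete {R : Type u} [SmallCategory R] [Quantaloid R] (C : QCat R) : Prop :=
  ∀ (A : QCat R) (Φ : Distributor A C), Φ.IsCauchy →
    ∃ F : QFunctor A C, Φ = Distributor.ofFunctor F

/-- The locally ordered category `Cat(R)`: enriched categories, functors, and a single 2-cell
`F ⟶ G` exactly when `F ≤ G`. -/
instance QCat.instBicategory (R : Type u) [SmallCategory R] [Quantaloid R] :
    Bicategory.{u, u} (QCat R) where
  Hom A B := QFunctor A B
  id A := QFunctor.id A
  comp F G := QFunctor.comp F G
  homCategory A B := inferInstanceAs (Category (QFunctor A B))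
  whiskerLeft F _ _ η := homOfLE (QFunctor.comp_mono (le_refl F) (leOfHom η))
  whiskerRight η H := homOfLE (QFunctor.comp_mono (leOfHom η) (le_refl H))
  associator F G H := Iso.refl (QFunctor.comp F (QFunctor.comp G H))
  leftUnitor F := Iso.refl F
  rightUnitor F := Iso.refl F
  whiskerLeft_id _ _ := Subsingleton.elim _ _
  whiskerLeft_comp _ _ _ _ _ _ := Subsingleton.elim _ _
  id_whiskerLeft _ := Subsingleton.elim _ _
  comp_whiskerLeft _ _ _ _ _ := Subsingleton.elim _ _
  id_whiskerRight _ _ := Subsingleton.elim _ _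
  comp_whiskerRight _ _ _ := Subsingleton.elim _ _
  whiskerRight_id _ := Subsingleton.elim _ _
  whiskerRight_comp _ _ _ := Subsingleton.elim _ _
  whisker_assoc _ _ _ _ _ := Subsingleton.elim _ _
  whisker_exchange _ _ := Subsingleton.elim _ _
  pentagon _ _ _ _ := Subsingleton.elim _ _
  triangle _ _ := Subsingleton.elim _ _

/-- Cauchy complete enriched categories. -/
structure CauchyCat (R : Type u) [SmallCategory R] [Quantaloid R] where
  toQCat : QCat R
  cauchyComplete : CauchyComplete toQCat

/-- `Cat_cc(R)`, the full locally ordered subcategory of `Cat(R)` on the Cauchy complete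
enriched categories. -/
instance CauchyCat.instBicategory (R : Type u) [SmallCategory R] [Quantaloid R] :
    Bicategory.{u, u} (CauchyCat R) where
  Hom A B := QFunctor A.toQCat B.toQCat
  id A := QFunctor.id A.toQCat
  comp F G := QFunctor.comp F G
  homCategory A B := inferInstanceAs (Category (QFunctor A.toQCat B.toQCat))
  whiskerLeft F _ _ η := homOfLE (QFunctor.comp_mono (le_refl F) (leOfHom η))
  whiskerRight η H := homOfLE (QFunctor.comp_mono (leOfHom η) (le_refl H))
  associator F G H := Iso.refl (QFunctor.comp F (QFunctor.comp G H))
  leftUnitor F := Iso.refl F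
  rightUnitor F := Iso.refl F
  whiskerLeft_id _ _ := Subsingleton.elim _ _
  whiskerLeft_comp _ _ _ _ _ _ := Subsingleton.elim _ _
  id_whiskerLeft _ := Subsingleton.elim _ _
  comp_whiskerLeft _ _ _ _ _ := Subsingleton.elim _ _
  id_whiskerRight _ _ := Subsingleton.elim _ _
  comp_whiskerRight _ _ _ := Subsingleton.elim _ _
  whiskerRight_id _ := Subsingleton.elim _ _
  whiskerRight_comp _ _ _ := Subsingleton.elim _ _
  whisker_assoc _ _ _ _ _ := Subsingleton.elim _ _
  whisker_exchange _ _ := Subsingleton.elim _ _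
  pentagon _ _ _ _ := Subsingleton.elim _ _
  triangle _ _ := Subsingleton.elim _ _

/-- The locally ordered category `Ord(Q) = Cat_cc(Idm(Q))` of ordered sheaves on `Q`. -/
abbrev Ord (Q : Type u) [SmallCategory Q] [Quantaloid Q] : Type (u + 1) := CauchyCat (Idm Q)

open scoped Pseudofunctor.StrongTrans in
/-- A biequivalence of bicategories: pseudofunctors in both directions, mutually inverse up to
equivalence in the bicategories of pseudofunctors, strong transformations and modifications. -/
structure Biequivalence (B : Type u₁) [Bicategory.{w, v₁} B]
    (C : Type u₂) [Bicategory.{w, v₂} C] where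
  functor : Pseudofunctor B C
  inverse : Pseudofunctor C B
  unit : Bicategory.Equivalence (Pseudofunctor.id B) (functor.comp inverse)
  counit : Bicategory.Equivalence (inverse.comp functor) (Pseudofunctor.id C)

/-! ### The centre of a quantaloid -/

/-- The endo-arrows of an object of a quantaloid are ordered by the local order. -/
instance End.instCompleteLattice {C : Type u} [Category.{v} C] [Quantaloid C] (X : C) :
    CompleteLattice (End X) :=
  Quantaloid.homLattice X X

/-- The endo-arrows of an object of a quantaloid form a quantale under composition. -/
instance End.instIsQuantale {C : Type u} [Category.{v} C] [Quantaloid C] (X : C) :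
    IsQuantale (End X) where
  mul_sSup_distrib f S := (Quantaloid.sSup_comp (X := X) (Y := X) (Z := X) S f).trans sSup_image
  sSup_mul_distrib S f := (Quantaloid.comp_sSup (X := X) (Y := X) (Z := X) f S).trans sSup_image

/-- The centre of a quantaloid `C`: the quantale `QUANT(C, C)(Id, Id)` of natural
endo-transformations of the identity, with composition and the componentwise order. -/
abbrev Centre (C : Type u) [Category.{v} C] [Quantaloid C] : Type (max u v) := End (QHom.id C)

end QOrd

/-! (1) An equivalence of quantaloids extends to the split-idempotent completions. Enriched
categories can then be pulled back along it. Pulling back there and back gives `A` with its types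
replaced by isomorphic ones, and a Cauchy complete `A` contains, for every object and every
isomorphism onto its type, a copy of that object shifted along the isomorphism
(`CauchyComplete.exists_isShift`). Choosing shifts gives the unit and counit; coherence is automatic
because the hom-categories are preorders.

(2) The idea is to recover `Mod R` (for `R = Idm Q`) from the ordered category of Cauchy complete
`R`-categories by notions that any biequivalence respects. Identifying isomorphic functors turns a
biequivalence into an ordinary equivalence that is an order embedding on homs. Fully faithful
functors are then characterised as the arrows with the lifting property against those whose
precomposition reflects the order (`OrdCat.laxEpi_mk_iff`, `OrdCat.embedding_mk_iff`). The objects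
injective for them are exactly the categories of elements of modules: maps into a module extend by a
Kan extension formula, and an injective object is a retract of its presheaf module, hence the closed
elements of a nucleus (`Mod.exists_iso_of_embeddingInjective`). Left adjoint functors between
modules are the module homomorphisms. So `Mod (Idm Q)` is determined, and it is equivalent to `Mod
Q` because modules take values in suplattices, where idempotents split.

(3) The centre of a quantaloid is invariant under equivalence, and the centre of `Q` acts on every
module. By the Yoneda argument a central endomorphism of all modules is given by its values on the
identities in the representables, so `Q` and `Mod Q` have the same centre. -/

namespace QOrd

universe w v v₁ u₁ v₂ u₂

/-! ### Cauchy completeness through presheaves -/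

section CauchyPresheaf

variable {R : Type u} [SmallCategory R] [Quantaloid R]

/-- Inserting `𝟙 X ≤ ⋁ S` in front of `f` splits the inequality into pieces. This is how units of
adjunctions and absolute colimits are used throughout. -/
theorem Quantaloid.le_of_one_le_sSup_left {X Y : R} {S : Set (X ⟶ X)} (h : 𝟙 X ≤ sSup S)
    {f g : X ⟶ Y} (hS : ∀ s ∈ S, s ≫ f ≤ g) : f ≤ g := by
  have h₁ : 𝟙 X ≫ f ≤ sSup S ≫ f := Quantaloid.comp_mono h le_rfl
  rw [Category.id_comp, Quantaloid.sSup_comp] at h₁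
  refine h₁.trans (sSup_le ?_)
  rintro _ ⟨s, hs, rfl⟩
  exact hS s hs

theorem Quantaloid.le_of_one_le_sSup_right {X Y : R} {S : Set (X ⟶ X)} (h : 𝟙 X ≤ sSup S)
    {f g : Y ⟶ X} (hS : ∀ s ∈ S, f ≫ s ≤ g) : f ≤ g := by
  have h₁ : f ≫ 𝟙 X ≤ f ≫ sSup S := Quantaloid.comp_mono le_rfl h
  rw [Category.comp_id, Quantaloid.comp_sSup] at h₁
  refine h₁.trans (sSup_le ?_)
  rintro _ ⟨s, hs, rfl⟩
  exact hS s hs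

theorem Quantaloid.le_comp_of_one_le {X Y : R} {f : X ⟶ Y} {g : Y ⟶ Y} (h : 𝟙 Y ≤ g) :
    f ≤ f ≫ g := by
  simpa using Quantaloid.comp_mono (le_refl f) h

theorem Quantaloid.le_one_comp_of_le {X Y : R} {f : X ⟶ X} {g : X ⟶ Y} (h : 𝟙 X ≤ f) :
    g ≤ f ≫ g := by
  simpa using Quantaloid.comp_mono h (le_refl g)

/-- A left adjoint presheaf of type `X` on `A`, together with its right adjoint. -/
structure CauchyPresheaf (A : QCat R) (X : R) where
  left : ∀ {Y : R}, A.obj Y → (X ⟶ Y)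
  right : ∀ {Y : R}, A.obj Y → (Y ⟶ X)
  left_le : ∀ {Y Y' : R} (a : A.obj Y) (a' : A.obj Y'), left a' ≫ A.hom a a' ≤ left a
  right_le : ∀ {Y Y' : R} (a : A.obj Y) (a' : A.obj Y'), A.hom a' a ≫ right a' ≤ right a
  unit : 𝟙 X ≤ sSup {f | ∃ (Y : R) (a : A.obj Y), f = left a ≫ right a}
  counit : ∀ {Y Y' : R} (a : A.obj Y) (a' : A.obj Y'), right a ≫ left a' ≤ A.hom a' a

namespace CauchyPresheaf

variable {A : QCat R} {X : R} (P : CauchyPresheaf A X)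

/-- The object `h` represents the presheaf. -/
def RepresentedBy (h : A.obj X) : Prop :=
  (∀ {Y : R} (b : A.obj Y), A.hom b h = P.left b) ∧ ∀ {Y : R} (b : A.obj Y), A.hom h b = P.right b

variable {P}

/-- Enlarging a left adjoint shrinks its right adjoint, so two adjoint pairs comparable in the same
direction on both sides coincide. -/
theorem RepresentedBy.of_le {h : A.obj X} (hl : ∀ {Y : R} (b : A.obj Y), P.left b ≤ A.hom b h)
    (hr : ∀ {Y : R} (b : A.obj Y), P.right b ≤ A.hom h b) : P.RepresentedBy h := by
  refine ⟨fun {Y} b => le_antisymm ?_ (hl b), fun {Y} b => le_antisymm ?_ (hr b)⟩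
  · refine Quantaloid.le_of_one_le_sSup_left P.unit ?_
    rintro _ ⟨Z, c, rfl⟩
    rw [Category.assoc]
    exact (Quantaloid.comp_mono le_rfl ((Quantaloid.comp_mono (hr c) le_rfl).trans
      (A.comp_le b h c))).trans (P.left_le b c)
  · refine Quantaloid.le_of_one_le_sSup_right P.unit ?_
    rintro _ ⟨Z, c, rfl⟩
    rw [← Category.assoc]
    exact (Quantaloid.comp_mono ((Quantaloid.comp_mono le_rfl (hl c)).trans
      (A.comp_le c h b)) le_rfl).trans (P.right_le b c)

theorem RepresentedBy.of_left_eq {h : A.obj X}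
    (hl : ∀ {Y : R} (b : A.obj Y), P.left b = A.hom b h) : P.RepresentedBy h := by
  refine RepresentedBy.of_le (fun b => (hl b).le) fun b => ?_
  refine (Quantaloid.le_comp_of_one_le ((A.id_le h).trans (hl h).ge)).trans (P.counit b h)

end CauchyPresheaf

/-- The one-object enriched category of type `X`. -/
def QCat.single (X : R) : QCat R where
  obj Y := ULift.{u} (PLift (X = Y))
  hom p q := eqToHom (q.down.down.symm.trans p.down.down)
  comp_le _ _ _ := by simp
  id_le _ := by simp

/-- A presheaf of type `X` is a distributor out of the one-object category of type `X`; the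
`eqToHom` factors appear because the objects of that category are proofs of an equality of types. -/
theorem CauchyComplete.exists_representedBy {A : QCat R} (hA : CauchyComplete A) {X : R}
    (P : CauchyPresheaf A X) : ∃ h : A.obj X, P.RepresentedBy h := by
  let Φ : Distributor (QCat.single X) A :=
    { app := fun b p => eqToHom p.down.down.symm ≫ P.left b
      comp_left_le := fun b b' p => by
        rw [Category.assoc]
        exact Quantaloid.comp_mono le_rfl (P.left_le b b')
      comp_right_le := fun b p q => by simp [QCat.single] }
  let Ψ : Distributor A (QCat.single X) :=
    { app := fun p b => P.right b ≫ eqToHom p.down.down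
      comp_left_le := fun p q b => by simp [QCat.single]
      comp_right_le := fun p a' a => by
        rw [← Category.assoc]
        exact Quantaloid.comp_mono (P.right_le a a') le_rfl }
  have hΦ : Φ.IsCauchy := by
    refine ⟨Ψ, ?_, ?_⟩
    · rintro _ _ ⟨⟨rfl⟩⟩ ⟨⟨rfl⟩⟩
      refine P.unit.trans (sSup_le_sSup ?_)
      rintro _ ⟨Y, a, rfl⟩
      exact ⟨Y, a, by simp [Φ, Ψ]⟩
    · intro Y Z b a
      refine sSup_le ?_
      rintro _ ⟨_, ⟨⟨rfl⟩⟩, rfl⟩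
      simpa [Φ, Ψ, Distributor.id] using P.counit a b
  obtain ⟨F, hF⟩ := hA _ Φ hΦ
  refine ⟨F.map (X := X) ⟨⟨rfl⟩⟩, .of_left_eq fun {Y} b => ?_⟩
  have h := congrArg (fun D : Distributor (QCat.single X) A => D.app b
    (ULift.up (PLift.up (rfl : X = X)))) hF
  simpa [Φ, Distributor.ofFunctor] using h

/-- A left adjoint distributor `Φ` is a left adjoint presheaf `Φ(-, b)` for each `b`. Representing
objects chosen independently for each `b` automatically form a functor, by the right action on `Φ`.
-/
theorem CauchyComplete.of_representedBy {A : QCat R}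
    (hA : ∀ (X : R) (P : CauchyPresheaf A X), ∃ h : A.obj X, P.RepresentedBy h) :
    CauchyComplete A := by
  rintro B Φ ⟨Ψ, h₁, h₂⟩
  have key : ∀ (X : R) (b : B.obj X), ∃ h : A.obj X, ∀ (Y : R) (a : A.obj Y),
      A.hom a h = Φ.app a b := fun X b => by
    obtain ⟨h, hh⟩ := hA X
      { left := fun a => Φ.app a b
        right := fun a => Ψ.app b a
        left_le := fun a a' => Φ.comp_left_le a a' b
        right_le := fun a a' => Ψ.comp_right_le b a' a
        unit := (B.id_le b).trans (h₁ X X b b)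
        counit := fun a a' => le_trans (b := (Distributor.tensor Φ Ψ).app a' a)
          (le_sSup ⟨X, b, rfl⟩) (h₂ _ _ a' a) }
    exact ⟨h, fun Y a => hh.1 a⟩
  choose F hF using key
  refine ⟨⟨fun b => F _ b, fun a' a => ?_⟩, ?_⟩
  · rw [hF]
    refine (Quantaloid.le_comp_of_one_le ((A.id_le (F _ a')).trans (hF _ a' _ _).le)).trans
      (Φ.comp_right_le _ a' a)
  · ext Y X b a
    exact (hF _ a _ b).symm


theorem QCat.hom_le_hom_right (A : QCat R) {X Y : R} (a : A.obj X) {b b' : A.obj Y}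
    (h : 𝟙 Y ≤ A.hom b b') : A.hom a b ≤ A.hom a b' :=
  (Quantaloid.le_one_comp_of_le h).trans (A.comp_le a b b')

theorem QCat.hom_le_hom_left (A : QCat R) {X Y : R} {b b' : A.obj Y} (a : A.obj X)
    (h : 𝟙 Y ≤ A.hom b b') : A.hom b' a ≤ A.hom b a :=
  (Quantaloid.le_comp_of_one_le h).trans (A.comp_le b b' a)

/-- In a Cauchy complete category, absolute weighted colimits of families exist. -/
theorem CauchyComplete.exists_of_family {A : QCat R} (hA : CauchyComplete A) {X : R} {ι : Type*}
    {t : ι → R} (y : ∀ i, A.obj (t i)) (l : ∀ i, X ⟶ t i) (r : ∀ i, t i ⟶ X)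
    (unit : 𝟙 X ≤ sSup {f | ∃ i, f = l i ≫ r i})
    (counit : ∀ i j, r i ≫ l j ≤ A.hom (y j) (y i)) :
    ∃ h : A.obj X, (∀ i, l i ≤ A.hom (y i) h) ∧ ∀ i, r i ≤ A.hom h (y i) := by
  have hl : ∀ i, l i ≤ sSup {f | ∃ j, f = l j ≫ A.hom (y i) (y j)} := fun i =>
    (Quantaloid.le_comp_of_one_le (A.id_le _)).trans (le_sSup ⟨i, rfl⟩)
  have hr : ∀ i, r i ≤ sSup {f | ∃ j, f = A.hom (y j) (y i) ≫ r j} := fun i =>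
    (Quantaloid.le_one_comp_of_le (A.id_le _)).trans (le_sSup ⟨i, rfl⟩)
  -- The weight on the family is extended to all of `A` by composing with the homs to and from the
  -- `y i`; `hl` and `hr` recover `l` and `r` inside the extension.
  obtain ⟨h, hh⟩ := hA.exists_representedBy
    { left := fun a => sSup {f | ∃ i, f = l i ≫ A.hom a (y i)}
      right := fun a => sSup {f | ∃ i, f = A.hom (y i) a ≫ r i}
      left_le := fun a a' => by
        rw [Quantaloid.sSup_comp]
        refine sSup_le ?_
        rintro _ ⟨_, ⟨i, rfl⟩, rfl⟩
        refine le_trans ?_ (le_sSup ⟨i, rfl⟩)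
        change (l i ≫ A.hom a' (y i)) ≫ _ ≤ _
        rw [Category.assoc]
        exact Quantaloid.comp_mono le_rfl (A.comp_le _ _ _)
      right_le := fun a a' => by
        rw [Quantaloid.comp_sSup]
        refine sSup_le ?_
        rintro _ ⟨_, ⟨i, rfl⟩, rfl⟩
        refine le_trans ?_ (le_sSup ⟨i, rfl⟩)
        change _ ≫ A.hom (y i) a' ≫ r i ≤ _
        rw [← Category.assoc]
        exact Quantaloid.comp_mono (A.comp_le _ _ _) le_rfl
      unit := by
        refine unit.trans (sSup_le ?_)
        rintro _ ⟨i, rfl⟩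
        exact (Quantaloid.comp_mono (hl i) (hr i)).trans (le_sSup ⟨_, y i, rfl⟩)
      counit := fun a a' => by
        rw [Quantaloid.sSup_comp]
        refine sSup_le ?_
        rintro _ ⟨_, ⟨i, rfl⟩, rfl⟩
        change (A.hom (y i) a ≫ r i) ≫ _ ≤ _
        rw [Quantaloid.comp_sSup]
        refine sSup_le ?_
        rintro _ ⟨_, ⟨j, rfl⟩, rfl⟩
        change (A.hom (y i) a ≫ r i) ≫ l j ≫ A.hom a' (y j) ≤ _
        have h : (A.hom (y i) a ≫ r i) ≫ l j ≫ A.hom a' (y j) =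
          A.hom (y i) a ≫ (r i ≫ l j) ≫ A.hom a' (y j) := by simp
        rw [h]
        exact (Quantaloid.comp_mono le_rfl ((Quantaloid.comp_mono (counit i j) le_rfl).trans
          (A.comp_le _ _ _))).trans (A.comp_le _ _ _) }
  exact ⟨h, fun i => (hl i).trans (hh.1 (y i)).ge, fun i => (hr i).trans (hh.2 (y i)).ge⟩

end CauchyPresheaf

/-! ### Locally ordered categories -/

/-- A category enriched in partially ordered sets. -/
class LocallyOrdered (C : Type u) [Category.{v} C] where
  homOrder : ∀ X Y : C, PartialOrder (X ⟶ Y)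
  comp_mono : ∀ {X Y Z : C} {f f' : X ⟶ Y} {g g' : Y ⟶ Z}, f ≤ f' → g ≤ g' → f ≫ g ≤ f' ≫ g'

attribute [reducible, instance] LocallyOrdered.homOrder

namespace LocallyOrdered

section Invariants

variable {C : Type u₁} [Category.{v₁} C] [LocallyOrdered C]

theorem comp_left_mono {X Y Z : C} (f : X ⟶ Y) {g g' : Y ⟶ Z} (h : g ≤ g') : f ≫ g ≤ f ≫ g' :=
  comp_mono le_rfl h

theorem comp_right_mono {X Y Z : C} {f f' : X ⟶ Y} (h : f ≤ f') (g : Y ⟶ Z) : f ≫ g ≤ f' ≫ g :=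
  comp_mono h le_rfl

theorem comp_iso_le_iff {X Y Z : C} {f f' : X ⟶ Y} (i : Y ≅ Z) :
    f ≫ i.hom ≤ f' ≫ i.hom ↔ f ≤ f' :=
  ⟨fun h => by simpa using comp_right_mono h i.inv, fun h => comp_right_mono h _⟩

theorem iso_comp_le_iff {X Y Z : C} {f f' : Y ⟶ Z} (i : X ≅ Y) :
    i.hom ≫ f ≤ i.hom ≫ f' ↔ f ≤ f' :=
  ⟨fun h => by simpa using comp_left_mono i.inv h, fun h => comp_left_mono _ h⟩

/-- Precomposition with a lax epimorphism reflects the order. -/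
def LaxEpi {D E : C} (L : D ⟶ E) : Prop :=
  ∀ ⦃Z : C⦄ (F G : E ⟶ Z), L ≫ F ≤ L ≫ G → F ≤ G

/-- Embeddings have the right lifting property with respect to lax epimorphisms. -/
def Embedding {X Y : C} (J : X ⟶ Y) : Prop :=
  ∀ ⦃D E : C⦄ (L : D ⟶ E), LaxEpi L → ∀ (U : D ⟶ X) (V : E ⟶ Y), U ≫ J = L ≫ V →
    ∃ W : E ⟶ X, L ≫ W = U ∧ W ≫ J = V

/-- Objects that are injective with respect to embeddings. -/
def EmbeddingInjective (A : C) : Prop :=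
  ∀ ⦃X Y : C⦄ (J : X ⟶ Y), Embedding J → ∀ F : X ⟶ A, ∃ G : Y ⟶ A, J ≫ G = F

/-- Arrows with a right adjoint. -/
def LeftAdj {X Y : C} (F : X ⟶ Y) : Prop :=
  ∃ G : Y ⟶ X, 𝟙 X ≤ F ≫ G ∧ G ≫ F ≤ 𝟙 Y

theorem LeftAdj.of_iso {X Y : C} (i : X ≅ Y) : LeftAdj i.hom := ⟨i.inv, by simp, by simp⟩

theorem LeftAdj.comp {X Y Z : C} {F : X ⟶ Y} {F' : Y ⟶ Z} (h : LeftAdj F) (h' : LeftAdj F') :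
    LeftAdj (F ≫ F') := by
  obtain ⟨G, h₁, h₂⟩ := h
  obtain ⟨G', h₁', h₂'⟩ := h'
  refine ⟨G' ≫ G, ?_, ?_⟩
  · refine h₁.trans ?_
    simpa using comp_left_mono F (comp_right_mono h₁' G)
  · refine le_trans ?_ h₂'
    simpa using comp_left_mono G' (comp_right_mono h₂ F')

theorem Embedding.comp_iso {X Y X' Y' : C} {J : X ⟶ Y} (hJ : Embedding J) (i : X' ≅ X)
    (j : Y ≅ Y') : Embedding (i.hom ≫ J ≫ j.hom) := by
  intro D E L hL U V h
  obtain ⟨W, h₁, h₂⟩ := hJ L hL (U ≫ i.hom) (V ≫ j.inv) (by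
    rw [← Category.assoc L, ← h]
    simp)
  refine ⟨W ≫ i.inv, ?_, ?_⟩
  · rw [← Category.assoc, h₁]
    simp
  · simp [reassoc_of% h₂]

theorem EmbeddingInjective.of_iso {A A' : C} (hA : EmbeddingInjective A) (i : A ≅ A') :
    EmbeddingInjective A' := by
  intro X Y J hJ F
  obtain ⟨G, hG⟩ := hA J hJ (F ≫ i.inv)
  exact ⟨G ≫ i.hom, by rw [← Category.assoc, hG]; simp⟩

end Invariants

theorem exists_iso_map_inv_map {C : Type u₁} [Category.{v₁} C] {D : Type u₂} [Category.{v₂} D]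
    (F : C ⥤ D) [F.IsEquivalence] : ∃ e : ∀ X : D, F.obj (F.inv.obj X) ≅ X,
      ∀ {X Y : D} (k : X ⟶ Y), F.map (F.inv.map k) = (e X).hom ≫ k ≫ (e Y).inv :=
  ⟨fun X => F.asEquivalence.counitIso.app X, fun k => F.fun_inv_map _ _ k⟩

/-! ### Invariance of these notions under order-embedding equivalences. -/

section Transport

variable {C : Type u₁} [Category.{v₁} C] [LocallyOrdered C]
  {D : Type u₂} [Category.{v₂} D] [LocallyOrdered D]

/-- A functor that is an order embedding on hom-sets. -/
def HomOrderEmbedding (Φ : C ⥤ D) : Prop :=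
  ∀ ⦃X Y : C⦄ (f g : X ⟶ Y), Φ.map f ≤ Φ.map g ↔ f ≤ g

/-- To reflect an inequality, apply `Ψ` and conjugate by `η`. -/
theorem HomOrderEmbedding.of_iso {Φ : C ⥤ D} {Ψ : D ⥤ C} (η : 𝟭 C ≅ Φ ⋙ Ψ)
    (hΦ : ∀ ⦃X Y : C⦄ ⦃f g : X ⟶ Y⦄, f ≤ g → Φ.map f ≤ Φ.map g)
    (hΨ : ∀ ⦃X Y : D⦄ ⦃f g : X ⟶ Y⦄, f ≤ g → Ψ.map f ≤ Ψ.map g) : HomOrderEmbedding Φ := by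
  refine fun X Y f g => ⟨fun h => ?_, fun h => hΦ h⟩
  rw [← comp_iso_le_iff (η.app Y)]
  have h₁ := η.hom.naturality f
  have h₂ := η.hom.naturality g
  simp only [Functor.id_map, Functor.comp_map, Functor.id_obj, Functor.comp_obj] at h₁ h₂
  simp only [Iso.app_hom, Functor.id_obj, Functor.comp_obj, h₁, h₂]
  exact comp_left_mono _ (hΨ h)

variable {Φ : C ⥤ D} [Φ.IsEquivalence]

theorem HomOrderEmbedding.inv (hΦ : HomOrderEmbedding Φ) : HomOrderEmbedding Φ.inv := by
  intro X Y f g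
  obtain ⟨e, he⟩ := exists_iso_map_inv_map Φ
  rw [← hΦ, he, he, iso_comp_le_iff, ← Iso.symm_hom, comp_iso_le_iff]

theorem LaxEpi.map (hΦ : HomOrderEmbedding Φ) {X Y : C} {L : X ⟶ Y} (hL : LaxEpi L) :
    LaxEpi (Φ.map L) := by
  intro Z F G h
  rw [← comp_iso_le_iff (Φ.objObjPreimageIso Z).symm, ← Φ.map_preimage (F ≫ _),
    ← Φ.map_preimage (G ≫ _), hΦ]
  refine hL _ _ ?_
  rw [← hΦ]
  simpa using comp_right_mono h _

/-- Lifting problems in `C` are sent to lifting problems in `D` because lax epimorphisms are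
preserved; fullness and faithfulness bring the solution back. -/
theorem Embedding.of_map (hΦ : HomOrderEmbedding Φ) {X Y : C} {J : X ⟶ Y}
    (hJ : Embedding (Φ.map J)) : Embedding J := by
  intro D E L hL U V h
  obtain ⟨W, h₁, h₂⟩ := hJ _ (hL.map hΦ) (Φ.map U) (Φ.map V) (by simp [← Functor.map_comp, h])
  exact ⟨Φ.preimage W, Φ.map_injective (by simpa using h₁), Φ.map_injective (by simpa using h₂)⟩

theorem EmbeddingInjective.map (hΦ : HomOrderEmbedding Φ) {A : C} (hA : EmbeddingInjective A) :
    EmbeddingInjective (Φ.obj A) := by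
  intro X Y J hJ F
  let i := Φ.objObjPreimageIso X
  let j := Φ.objObjPreimageIso Y
  have hJ' : Embedding (Φ.preimage (i.hom ≫ J ≫ j.symm.hom)) :=
    Embedding.of_map hΦ (by simpa using hJ.comp_iso i j.symm)
  obtain ⟨G, hG⟩ := hA _ hJ' (Φ.preimage (i.hom ≫ F))
  refine ⟨j.inv ≫ Φ.map G, ?_⟩
  have h := congrArg Φ.map hG
  simpa using h

theorem embeddingInjective_map_iff (hΦ : HomOrderEmbedding Φ) {A : C} :
    EmbeddingInjective (Φ.obj A) ↔ EmbeddingInjective A :=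
  ⟨fun h => (h.map hΦ.inv).of_iso (Φ.asEquivalence.unitIso.app A).symm, fun h => h.map hΦ⟩

theorem leftAdj_map_iff (hΦ : HomOrderEmbedding Φ) {X Y : C} {F : X ⟶ Y} :
    LeftAdj (Φ.map F) ↔ LeftAdj F := by
  constructor
  · rintro ⟨G, h₁, h₂⟩
    refine ⟨Φ.preimage G, ?_, ?_⟩
    · rw [← hΦ]
      simpa using h₁
    · rw [← hΦ]
      simpa using h₂
  · rintro ⟨G, h₁, h₂⟩
    refine ⟨Φ.map G, ?_, ?_⟩
    · rwa [← Φ.map_id, ← Φ.map_comp, hΦ]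
    · rwa [← Φ.map_id, ← Φ.map_comp, hΦ]

end Transport

/-- A functor from a quantaloid identifying it, up to equivalence, with the category of
embedding-injective objects and left adjoint arrows of a locally ordered category. -/
structure InjectiveModel {M : Type u₁} [Category.{v₁} M] [Quantaloid M]
    {C : Type u₂} [Category.{v₂} C] [LocallyOrdered C] (T : M ⥤ C) : Prop where
  le_iff : ∀ {X Y : M} (f g : X ⟶ Y), T.map f ≤ T.map g ↔ f ≤ g
  leftAdj_iff : ∀ {X Y : M} (F : T.obj X ⟶ T.obj Y), LeftAdj F ↔ ∃ f, T.map f = F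
  injective_iff : ∀ A : C, EmbeddingInjective A ↔ ∃ X, Nonempty (T.obj X ≅ A)

theorem InjectiveModel.comp {M : Type u} [Category.{v} M] [Quantaloid M]
    {C : Type u₁} [Category.{v₁} C] [LocallyOrdered C] {T : M ⥤ C} (hT : InjectiveModel T)
    {D : Type u₂} [Category.{v₂} D] [LocallyOrdered D] {Φ : C ⥤ D} [Φ.IsEquivalence]
    (hΦ : HomOrderEmbedding Φ) : InjectiveModel (T ⋙ Φ) where
  le_iff f g := (hΦ _ _).trans (hT.le_iff f g)
  leftAdj_iff {X Y} F := by
    obtain ⟨F, rfl⟩ := Φ.map_surjective F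
    rw [leftAdj_map_iff hΦ, hT.leftAdj_iff]
    exact exists_congr fun f => ⟨fun h => congrArg Φ.map h, fun h => Φ.map_injective h⟩
  injective_iff A := by
    have i := Φ.objObjPreimageIso A
    constructor
    · intro h
      obtain ⟨X, ⟨e⟩⟩ := (hT.injective_iff _).1 ((embeddingInjective_map_iff hΦ).1 (h.of_iso i.symm))
      exact ⟨X, ⟨Φ.mapIso e ≪≫ i⟩⟩
    · rintro ⟨X, ⟨e⟩⟩
      exact (((hT.injective_iff _).2 ⟨X, ⟨Iso.refl _⟩⟩).map hΦ).of_iso e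

end LocallyOrdered

/-! ### Recovering a quantaloid from the injectives and left adjoints it models. -/

open LocallyOrdered

/-- An equivalence of categories between quantaloids that is an order embedding on hom-sets
underlies an equivalence of quantaloids. -/
theorem QEquiv.nonempty_of_isEquivalence {M : Type u₁} [Category.{v₁} M] [Quantaloid M]
    {N : Type u₂} [Category.{v₂} N] [Quantaloid N] (F : M ⥤ N) [F.IsEquivalence]
    (hF : ∀ {X Y : M} (f g : X ⟶ Y), F.map f ≤ F.map g ↔ f ≤ g) : Nonempty (QEquiv M N) := by
  have h₁ : PreservesSups F := by
    intro X Y S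
    let o : (X ⟶ Y) ≃o (F.obj X ⟶ F.obj Y) :=
      { toEquiv := (Functor.FullyFaithful.ofFullyFaithful F).homEquiv
        map_rel_iff' := hF _ _ }
    exact (map_sSup o S).trans rfl
  have h₂ : PreservesSups F.inv := by
    intro X Y S
    apply F.map_injective
    rw [h₁]
    obtain ⟨e, he⟩ := exists_iso_map_inv_map F
    rw [he, Quantaloid.sSup_comp, Quantaloid.comp_sSup, Set.image_image, Set.image_image]
    simp only [he]
  exact ⟨⟨⟨F, h₁⟩, ⟨F.inv, h₂⟩, F.asEquivalence.unitIso, F.asEquivalence.counitIso⟩⟩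

/-- Both quantaloids have the same essential image, the injectives. Conjugating by chosen
isomorphisms keeps arrows left adjoint, since isomorphisms are left adjoints, so arrows transfer
from one model to the other. -/
theorem LocallyOrdered.InjectiveModel.nonempty_qEquiv {M : Type u₁} [Category.{v₁} M] [Quantaloid M]
    {N : Type u₂} [Category.{v₂} N] [Quantaloid N] {C : Type u} [Category.{v} C] [LocallyOrdered C]
    {T : M ⥤ C} (hT : InjectiveModel T) {S : N ⥤ C} (hS : InjectiveModel S) :
    Nonempty (QEquiv M N) := by
  have inj : ∀ {X Y : N} {f g : X ⟶ Y}, S.map f = S.map g → f = g := fun h =>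
    le_antisymm ((hS.le_iff _ _).1 h.le) ((hS.le_iff _ _).1 h.ge)
  have h₀ : ∀ X : M, ∃ Y : N, Nonempty (S.obj Y ≅ T.obj X) := fun X =>
    (hS.injective_iff _).1 ((hT.injective_iff _).2 ⟨X, ⟨Iso.refl _⟩⟩)
  choose o e using h₀
  have e := fun X => (e X).some
  have h₁ : ∀ {X Y : M} (f : X ⟶ Y), ∃ g : o X ⟶ o Y,
      S.map g = (e X).hom ≫ T.map f ≫ (e Y).inv := fun {X Y} f =>
    (hS.leftAdj_iff _).1 ((LeftAdj.of_iso (e X)).comp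
      (((hT.leftAdj_iff _).2 ⟨f, rfl⟩).comp (LeftAdj.of_iso (e Y).symm)))
  choose m hm using @h₁
  let F : M ⥤ N :=
    { obj := o
      map := m
      map_id := fun X => inj (by simp [hm])
      map_comp := fun f g => inj (by simp [hm]) }
  have hF : ∀ {X Y : M} (f g : X ⟶ Y), F.map f ≤ F.map g ↔ f ≤ g := fun {X Y} f g => by
    rw [← hS.le_iff, ← hT.le_iff]
    change S.map (m f) ≤ S.map (m g) ↔ _
    rw [hm, hm, iso_comp_le_iff, ← Iso.symm_hom, comp_iso_le_iff]
  have : F.Faithful := ⟨fun h => le_antisymm ((hF _ _).1 h.le) ((hF _ _).1 h.ge)⟩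
  have : F.Full := ⟨fun {X Y} g => by
    obtain ⟨f, hf⟩ := (hT.leftAdj_iff _).1 ((LeftAdj.of_iso (e X).symm).comp
      (((hS.leftAdj_iff _).2 ⟨g, rfl⟩).comp (LeftAdj.of_iso (e Y))))
    exact ⟨f, inj (by change S.map (m f) = _; rw [hm, hf]; simp)⟩⟩
  have : F.EssSurj := ⟨fun Y => by
    obtain ⟨X, ⟨i⟩⟩ := (hT.injective_iff _).1 ((hS.injective_iff _).2 ⟨Y, ⟨Iso.refl _⟩⟩)
    obtain ⟨f, hf⟩ := (hS.leftAdj_iff _).1 (LeftAdj.of_iso (e X ≪≫ i))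
    obtain ⟨g, hg⟩ := (hS.leftAdj_iff _).1 (LeftAdj.of_iso (e X ≪≫ i).symm)
    exact ⟨X, ⟨⟨f, g, inj (by simp [hf, hg]), inj (by simp [hf, hg])⟩⟩⟩⟩
  have : F.IsEquivalence := { }
  exact QEquiv.nonempty_of_isEquivalence F hF

/-! ### The locally posetal reflection of `Cat_cc(R)` -/

/-- Cauchy complete categories, as objects of the category whose arrows are the isomorphism classes
of functors. -/
structure OrdCat (R : Type u) [SmallCategory R] [Quantaloid R] where
  of ::
  cat : CauchyCat R

theorem CauchyCat.nonempty_hom_iff {R : Type u} [SmallCategory R] [Quantaloid R] {A B : CauchyCat R}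
    {F G : A ⟶ B} :
    Nonempty (F ⟶ G) ↔ LE.le (α := QFunctor A.toQCat B.toQCat) F G :=
  ⟨fun ⟨η⟩ => leOfHom (X := QFunctor A.toQCat B.toQCat) η,
    fun h => ⟨homOfLE (X := QFunctor A.toQCat B.toQCat) h⟩⟩

theorem CauchyCat.map_le_map {R R' : Type u} [SmallCategory R] [Quantaloid R] [SmallCategory R']
    [Quantaloid R'] (P : Pseudofunctor (CauchyCat R) (CauchyCat R')) {A B : CauchyCat R}
    {F G : A ⟶ B} (h : LE.le (α := QFunctor A.toQCat B.toQCat) F G) :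
    LE.le (α := QFunctor (P.obj A).toQCat (P.obj B).toQCat) (P.map F) (P.map G) :=
  nonempty_hom_iff.1 ((nonempty_hom_iff.2 h).map P.map₂)

namespace OrdCat

variable {R : Type u} [SmallCategory R] [Quantaloid R]

instance instCategory : Category.{u} (OrdCat R) where
  Hom A B := Antisymmetrization (QFunctor A.cat.toQCat B.cat.toQCat) (· ≤ ·)
  id A := toAntisymmetrization _ (QFunctor.id _)
  comp {A B C} := Quotient.map₂ (sa := AntisymmRel.setoid _ _) (sb := AntisymmRel.setoid _ _)
    (sc := AntisymmRel.setoid _ _) QFunctor.comp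
    (fun _ _ h _ _ h' => ⟨QFunctor.comp_mono h.1 h'.1, QFunctor.comp_mono h.2 h'.2⟩)
  id_comp := by rintro _ _ ⟨f⟩; rfl
  comp_id := by rintro _ _ ⟨f⟩; rfl
  assoc := by rintro _ _ _ _ ⟨f⟩ ⟨g⟩ ⟨h⟩; rfl

/-- The isomorphism class of a functor. -/
def mk {A B : CauchyCat R} (F : QFunctor A.toQCat B.toQCat) : of A ⟶ of B :=
  toAntisymmetrization _ F

theorem exists_mk {A B : CauchyCat R} (F : of A ⟶ of B) :
    ∃ F' : QFunctor A.toQCat B.toQCat, mk F' = F :=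
  Quotient.exists_rep (s := AntisymmRel.setoid _ _) F

instance instLocallyOrdered : LocallyOrdered (OrdCat R) where
  homOrder A B := inferInstanceAs
    (PartialOrder (Antisymmetrization (QFunctor A.cat.toQCat B.cat.toQCat) (· ≤ ·)))
  comp_mono := by
    rintro _ _ _ ⟨f⟩ ⟨f'⟩ ⟨g⟩ ⟨g'⟩ h h'
    exact QFunctor.comp_mono h h'

theorem mk_le {A B : CauchyCat R} {F G : QFunctor A.toQCat B.toQCat} : mk F ≤ mk G ↔ F ≤ G :=
  Iff.rfl

theorem mk_eq {A B : CauchyCat R} {F G : QFunctor A.toQCat B.toQCat} :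
    mk F = mk G ↔ F ≤ G ∧ G ≤ F :=
  ⟨fun h => ⟨mk_le.1 h.le, mk_le.1 h.ge⟩, fun h => le_antisymm (mk_le.2 h.1) (mk_le.2 h.2)⟩

theorem mk_eq_of_iso {A B : CauchyCat R} {F G : A ⟶ B} (e : F ≅ G) : mk F = mk G :=
  mk_eq.2 ⟨leOfHom e.hom, leOfHom e.inv⟩

variable {R' : Type u} [SmallCategory R'] [Quantaloid R']

/-- The functor induced by a pseudofunctor. -/
def ofPseudofunctor (P : Pseudofunctor (CauchyCat R) (CauchyCat R')) : OrdCat R ⥤ OrdCat R' where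
  obj A := of (P.obj A.cat)
  map {A B} := Quotient.map (sa := AntisymmRel.setoid _ _) (sb := AntisymmRel.setoid _ _)
    (fun F : A.cat ⟶ B.cat => P.map F)
    (fun _ _ h => ⟨CauchyCat.map_le_map P h.1, CauchyCat.map_le_map P h.2⟩)
  map_id A := mk_eq_of_iso (P.mapId A.cat)
  map_comp := by
    rintro _ _ _ ⟨F⟩ ⟨G⟩
    exact mk_eq_of_iso (P.mapComp F G)

theorem ofPseudofunctor_mono (P : Pseudofunctor (CauchyCat R) (CauchyCat R')) {A B : OrdCat R} :
    ∀ {F G : A ⟶ B}, F ≤ G → (ofPseudofunctor P).map F ≤ (ofPseudofunctor P).map G := by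
  rintro ⟨F⟩ ⟨G⟩ h
  exact CauchyCat.map_le_map P h

open scoped Pseudofunctor.StrongTrans

/-- An equivalence of pseudofunctors induces a natural isomorphism. -/
def isoOfEquivalence {P P' : Pseudofunctor (CauchyCat R) (CauchyCat R')}
    (e : Bicategory.Equivalence P P') : ofPseudofunctor P ≅ ofPseudofunctor P' :=
  NatIso.ofComponents
    (fun A =>
      { hom := mk (e.hom.app A.cat)
        inv := mk (e.inv.app A.cat)
        hom_inv_id := (mk_eq_of_iso
          { hom := e.unit.hom.as.app A.cat, inv := e.unit.inv.as.app A.cat }).symm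
        inv_hom_id := mk_eq_of_iso
          { hom := e.counit.hom.as.app A.cat, inv := e.counit.inv.as.app A.cat } })
    (by
      rintro _ _ ⟨F⟩
      exact mk_eq_of_iso (e.hom.naturality F))

end OrdCat

/-- A biequivalence induces an equivalence of locally posetal reflections. -/
theorem Biequivalence.exists_homOrderEmbedding {R : Type u} [SmallCategory R] [Quantaloid R]
    {R' : Type u} [SmallCategory R'] [Quantaloid R']
    (b : Biequivalence (CauchyCat R) (CauchyCat R')) :
    ∃ Φ : OrdCat R ⥤ OrdCat R', Φ.IsEquivalence ∧ HomOrderEmbedding Φ := by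
  -- The functors induced by identity and composite pseudofunctors agree with the identity and
  -- composite functors on representatives of arrows, so the natural isomorphisms are rebuilt
  -- componentwise.
  let e : OrdCat R ≌ OrdCat R' := CategoryTheory.Equivalence.mk
    (OrdCat.ofPseudofunctor b.functor) (OrdCat.ofPseudofunctor b.inverse)
    (NatIso.ofComponents (fun A => (OrdCat.isoOfEquivalence b.unit).app A)
      (by rintro _ _ ⟨F⟩; exact (OrdCat.isoOfEquivalence b.unit).hom.naturality ⟦F⟧))
    (NatIso.ofComponents (fun A => (OrdCat.isoOfEquivalence b.counit).app A)
      (by rintro _ _ ⟨F⟩; exact (OrdCat.isoOfEquivalence b.counit).hom.naturality ⟦F⟧))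
  refine ⟨e.functor, e.isEquivalence_functor, .of_iso e.unitIso ?_ ?_⟩
  · exact fun _ _ _ _ h => OrdCat.ofPseudofunctor_mono _ h
  · exact fun _ _ _ _ h => OrdCat.ofPseudofunctor_mono _ h

open Opposite

/-! ### Modules as enriched categories -/

namespace Mod

variable {R : Type u} [SmallCategory R] [Quantaloid R]

/-- The suplattice of elements of type `X` of a module. -/
abbrev elems (M : Mod R) (X : R) : Type u := (M.obj (op X)).carrier

/-- The action of an arrow on an element of a module. -/
def act {M : Mod R} {X Y : R} (m : M.elems Y) (f : X ⟶ Y) : M.elems X :=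
  SupLat.fn (M.map f.op) m

section Action

variable {M : Mod R} {X Y Z : R}

theorem act_id (m : M.elems X) : act m (𝟙 X) = m := by
  unfold act
  rw [op_id, M.map_id]
  rfl

theorem act_comp (m : M.elems Z) (f : X ⟶ Y) (g : Y ⟶ Z) : act m (f ≫ g) = act (act m g) f := by
  unfold act
  rw [op_comp, M.map_comp]
  rfl

theorem sSup_act (S : Set (M.elems Y)) (f : X ⟶ Y) :
    act (sSup S) f = sSup ((fun m => act m f) '' S) :=
  map_sSup (SupLat.fn (M.map f.op)) S

theorem act_sSup (m : M.elems Y) (S : Set (X ⟶ Y)) :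
    act m (sSup S) = sSup ((fun f => act m f) '' S) := by
  have h : (sSup S).op = sSup (Quiver.Hom.op '' S) := by
    apply Quiver.Hom.unop_inj
    change sSup S = sSup (Quiver.Hom.unop '' (Quiver.Hom.op '' S))
    rw [Set.image_image]
    simp
  unfold act
  rw [h, M.preservesSups, Set.image_image]
  change ⨆ g ∈ _, SupLat.fn g m = _
  rw [iSup_image, sSup_image]

theorem act_mono {m m' : M.elems Y} {f f' : X ⟶ Y} (hm : m ≤ m') (hf : f ≤ f') :
    act m f ≤ act m' f' := by
  have h₁ : act m f ≤ act m' f := OrderHomClass.mono (SupLat.fn (M.map f.op)) hm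
  refine h₁.trans ?_
  have h := act_sSup m' {f, f'}
  rw [sSup_pair, sup_eq_right.2 hf, Set.image_pair, sSup_pair] at h
  rw [h]
  exact le_sup_left

/-- The largest arrow sending `m'` below `m`. -/
def res (m' : M.elems Y) (m : M.elems X) : X ⟶ Y := sSup {f | act m' f ≤ m}

theorem le_res_iff {m' : M.elems Y} {m : M.elems X} {f : X ⟶ Y} :
    f ≤ res m' m ↔ act m' f ≤ m := by
  refine ⟨fun h => (act_mono le_rfl h).trans ?_, fun h => le_sSup h⟩
  rw [res, act_sSup]
  refine sSup_le ?_
  rintro _ ⟨f, hf, rfl⟩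
  exact hf

theorem act_res_le (m' : M.elems Y) (m : M.elems X) : act m' (res m' m) ≤ m :=
  le_res_iff.1 le_rfl

theorem one_le_res_iff {m' m : M.elems X} : 𝟙 X ≤ res m' m ↔ m' ≤ m := by
  rw [le_res_iff, act_id]

end Action

/-- The enriched category of elements of a module. -/
def toQCat (M : Mod R) : QCat R where
  obj X := M.elems X
  hom m' m := res m' m
  comp_le m'' m' m := by
    rw [le_res_iff, act_comp]
    exact (act_mono (act_res_le _ _) le_rfl).trans (act_res_le _ _)
  id_le m := by rw [one_le_res_iff]

/-- The weighted colimit of a presheaf `P` can be computed in the suplattice, as the join of the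
elements `a` acted on by `P.left a`. -/
theorem cauchyComplete_toQCat (M : Mod R) : CauchyComplete M.toQCat := by
  refine .of_representedBy fun X P => ?_
  let h : M.elems X := sSup {m | ∃ (Y : R) (a : M.elems Y), m = act a (P.left (Y := Y) a)}
  refine ⟨h, .of_le (fun {Y} b => ?_) (fun {Y} b => ?_)⟩
  · refine le_res_iff.2 ?_
    exact le_sSup (a := act (M := M) b (P.left b)) ⟨Y, b, rfl⟩
  · refine le_res_iff.2 ?_
    rw [sSup_act]
    refine sSup_le ?_
    rintro _ ⟨_, ⟨Z, a, rfl⟩, rfl⟩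
    change act (act a (P.left (Y := Z) a)) (P.right b) ≤ _
    rw [← act_comp]
    exact le_res_iff.1 (P.counit b a)

/-- The Cauchy complete category of elements of a module. -/
def toCauchyCat (M : Mod R) : CauchyCat R := ⟨M.toQCat, M.cauchyComplete_toQCat⟩

theorem qfunctor_le_iff {M : Mod R} {A : QCat R} {F G : QFunctor A M.toQCat} :
    F ≤ G ↔ ∀ {X : R} (a : A.obj X),
      LE.le (α := M.elems X) (F.map a) (G.map a) :=
  ⟨fun h _ a => one_le_res_iff.1 (h _ a), fun h _ a => one_le_res_iff.2 (h a)⟩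

theorem qfunctor_act_le {M N : Mod R} (F : QFunctor M.toQCat N.toQCat) {X Y : R} (m : M.elems Y)
    (f : X ⟶ Y) : act (M := N) (F.map m) f ≤ F.map (act m f) :=
  le_res_iff.1 ((le_res_iff.2 le_rfl).trans (F.hom_le m (act m f)))

theorem qfunctor_mono {M N : Mod R} (F : QFunctor M.toQCat N.toQCat) {X : R} {m m' : M.elems X}
    (h : m ≤ m') : LE.le (α := N.elems X) (F.map m) (F.map m') :=
  one_le_res_iff.1 ((one_le_res_iff.2 h).trans (F.hom_le m m'))

/-- A fibrewise map compatible with the actions gives a functor. -/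
def qfunctorOfActLe {M N : Mod R} (F : ∀ X : R, M.elems X → N.elems X)
    (mono : ∀ (X : R), Monotone (F X))
    (h : ∀ {X Y : R} (m : M.elems Y) (f : X ⟶ Y), act (F Y m) f ≤ F X (act m f)) :
    QFunctor M.toQCat N.toQCat where
  map m := F _ m
  hom_le m' m := le_res_iff.2 ((h m' _).trans (mono _ (act_res_le m' m)))

end Mod

/-! ### Presheaves -/

/-- A presheaf of type `X` on `A`. -/
@[ext]
structure Presheaf {R : Type u} [SmallCategory R] [Quantaloid R] (A : QCat R) (X : R) where
  app : ∀ {Y : R}, A.obj Y → (X ⟶ Y)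
  app_le : ∀ {Y Y' : R} (a : A.obj Y) (a' : A.obj Y'), app a' ≫ A.hom a a' ≤ app a

namespace Presheaf

variable {R : Type u} [SmallCategory R] [Quantaloid R] {A : QCat R}

instance instCompleteLattice (X : R) : CompleteLattice (Presheaf A X) :=
  letI : PartialOrder (Presheaf A X) :=
    { le := fun φ ψ => ∀ (Y : R) (a : A.obj Y), φ.app a ≤ ψ.app a
      le_refl := fun _ _ _ => le_rfl
      le_trans := fun _ _ _ h h' Y a => (h Y a).trans (h' Y a)
      le_antisymm := fun φ ψ h h' => by
        ext Y a
        exact le_antisymm (h Y a) (h' Y a) }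
  letI : SupSet (Presheaf A X) := ⟨fun S =>
    { app := fun a => sSup ((fun φ : Presheaf A X => φ.app a) '' S)
      app_le := fun a a' => by
        rw [Quantaloid.sSup_comp]
        refine sSup_le ?_
        rintro _ ⟨_, ⟨φ, hφ, rfl⟩, rfl⟩
        exact (φ.app_le a a').trans (le_sSup ⟨φ, hφ, rfl⟩) }⟩
  completeLatticeOfSup _ fun S =>
    ⟨fun φ hφ Y a => le_sSup (Set.mem_image_of_mem (fun φ : Presheaf A X => φ.app a) hφ),
      fun ψ hψ Y a => sSup_le (a := ψ.app a) (s := (fun φ : Presheaf A X => φ.app a) '' S) (by rintro _ ⟨φ, hφ, rfl⟩; exact hψ hφ Y a)⟩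

theorem sSup_app {X : R} (S : Set (Presheaf A X)) {Y : R} (a : A.obj Y) :
    (sSup S).app a = sSup ((fun φ : Presheaf A X => φ.app a) '' S) := rfl

/-- The action of arrows on presheaves. -/
def comp {X' X : R} (f : X' ⟶ X) (φ : Presheaf A X) : Presheaf A X' where
  app a := f ≫ φ.app a
  app_le a a' := by
    rw [Category.assoc]
    exact Quantaloid.comp_mono le_rfl (φ.app_le a a')

variable (A)

/-- The module of presheaves. -/
def module : Mod R where
  obj X := ⟨Presheaf A X.unop⟩
  map {X Y} f :=
    ({ toFun := comp f.unop
       map_sSup' := fun S => by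
        ext Y a
        change f.unop ≫ sSup _ = sSup _
        rw [Quantaloid.comp_sSup, Set.image_image, Set.image_image]
        rfl } : sSupHom (Presheaf A X.unop) (Presheaf A Y.unop))
  map_id X := by
    refine sSupHom.ext fun φ => Presheaf.ext ?_
    funext Y a
    exact Category.id_comp _
  map_comp f g := by
    refine sSupHom.ext fun φ => Presheaf.ext ?_
    funext Y a
    exact Category.assoc _ _ _
  preservesSups {X Y} S := by
    apply SupLat.hom_ext
    intro φ
    apply Presheaf.ext
    funext Z a
    change sSup _ ≫ _ = Presheaf.app (⨆ g ∈ _, _ : Presheaf A Y.unop) a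
    rw [Quantaloid.sSup_comp, iSup_image, ← sSup_image, sSup_app, Set.image_image, Set.image_image]
    rfl

variable {A}

/-- The representable presheaf. -/
def repr {X : R} (a : A.obj X) : (module A).elems X :=
  ({ app := fun b => A.hom b a, app_le := fun b b' => A.comp_le b b' a } : Presheaf A X)

/-- The Yoneda lemma. -/
theorem res_repr {X Y : R} (a : A.obj Y) (φ : (module A).elems X) :
    Mod.res (repr a) φ = Presheaf.app (A := A) φ a := by
  refine eq_of_forall_le_iff fun f => ?_
  rw [Mod.le_res_iff]
  constructor
  · intro h
    exact (Quantaloid.le_comp_of_one_le (A.id_le a)).trans (h Y a)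
  · intro h Z b
    exact (Quantaloid.comp_mono h le_rfl).trans (Presheaf.app_le (A := A) φ b a)

/-- The Yoneda embedding. -/
def yoneda (A : QCat R) : QFunctor A (module A).toQCat where
  map a := repr a
  hom_le a' a := (res_repr a' (repr a)).ge

end Presheaf

/-! ### Lax epimorphisms and embeddings of enriched categories -/

namespace QFunctor

variable {R : Type u} [SmallCategory R] [Quantaloid R]

/-- The object `c` is an absolute colimit of objects in the image of `L`. -/
def IsAbsoluteColimit {D C : QCat R} (L : QFunctor D C) {X : R} (c : C.obj X) : Prop :=
  𝟙 X ≤ sSup {f | ∃ i : Σ Y : R, D.obj Y, f = C.hom (L.map i.2) c ≫ C.hom c (L.map i.2)}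

theorem isAbsoluteColimit_map {D C : QCat R} (L : QFunctor D C) {X : R} (d : D.obj X) :
    L.IsAbsoluteColimit (L.map d) :=
  (C.id_le _).trans ((Quantaloid.le_comp_of_one_le (C.id_le _)).trans (le_sSup ⟨⟨X, d⟩, rfl⟩))

/-- Fully faithful functors. -/
def FullyFaithful {A B : QCat R} (J : QFunctor A B) : Prop :=
  ∀ {X Y : R} (a' : A.obj Y) (a : A.obj X), B.hom (J.map a') (J.map a) ≤ A.hom a' a

/-- The full subcategory on the absolute colimits of objects in the image of a functor. -/
def absoluteImage {A B : QCat R} (J : QFunctor A B) : QCat R where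
  obj X := {b : B.obj X // J.IsAbsoluteColimit b}
  hom b' b := B.hom b'.1 b.1
  comp_le _ _ _ := B.comp_le _ _ _
  id_le _ := B.id_le _

/-- An absolute colimit of absolute colimits is absolute, so the representing object found in `B`
stays in the subcategory. -/
theorem cauchyComplete_absoluteImage {A B : QCat R} (J : QFunctor A B) (hB : CauchyComplete B) :
    CauchyComplete J.absoluteImage := by
  refine .of_representedBy fun X P => ?_
  have hu : 𝟙 X ≤ sSup {f | ∃ i : Σ Y : R, J.absoluteImage.obj Y, f = P.left i.2 ≫ P.right i.2} :=
    P.unit.trans (sSup_le_sSup (by rintro _ ⟨Y, a, rfl⟩; exact ⟨⟨Y, a⟩, rfl⟩))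
  obtain ⟨h, hl, hr⟩ := hB.exists_of_family (ι := Σ Y : R, J.absoluteImage.obj Y)
    (fun i => i.2.1) (fun i => P.left i.2) (fun i => P.right i.2) hu
    (fun i j => P.counit i.2 j.2)
  have hh : J.IsAbsoluteColimit h := by
    refine hu.trans (sSup_le ?_)
    rintro _ ⟨i, rfl⟩
    -- The absolute-colimit join for the object `i.2` is inserted between `P.left i.2` and `P.right
    -- i.2`; the two outer factors are then absorbed into homs to and from `h`.
    refine Quantaloid.le_of_one_le_sSup_left (f := P.right i.2) i.2.2
      (g := sSup {f | ∃ k : Σ Y : R, A.obj Y, f = B.hom (J.map k.2) i.2.1 ≫ B.hom h (J.map k.2)})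
      ?_ |> Quantaloid.comp_mono (le_refl (P.left i.2)) |>.trans ?_
    · rintro _ ⟨k, rfl⟩
      rw [Category.assoc]
      refine (Quantaloid.comp_mono le_rfl ?_).trans (le_sSup ⟨k, rfl⟩)
      exact (Quantaloid.comp_mono le_rfl (hr i)).trans (B.comp_le _ _ _)
    · rw [Quantaloid.comp_sSup]
      refine sSup_le ?_
      rintro _ ⟨_, ⟨k, rfl⟩, rfl⟩
      refine le_trans ?_ (le_sSup ⟨k, rfl⟩)
      change P.left i.2 ≫ B.hom (J.map k.2) i.2.1 ≫ B.hom h (J.map k.2) ≤ _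
      rw [← Category.assoc]
      exact Quantaloid.comp_mono ((Quantaloid.comp_mono (hl i) le_rfl).trans (B.comp_le _ _ _))
        le_rfl
  exact ⟨⟨h, hh⟩, .of_le (fun {Y} b => hl ⟨Y, b⟩) (fun {Y} b => hr ⟨Y, b⟩)⟩

end QFunctor

namespace OrdCat

variable {R : Type u} [SmallCategory R] [Quantaloid R]

/-- For the forward direction, test against presheaves on `C`: the Yoneda embedding lies below the
functor `G c = ⋁ d, C(-, L d) ∘ C(L d, c)` after precomposition with `L`, hence everywhere, and
evaluating at `c` gives the claim. Conversely, insert the join and pass through the objects `L d`.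
-/
theorem laxEpi_mk_iff {D C : CauchyCat R} {L : QFunctor D.toQCat C.toQCat} :
    LaxEpi (mk L) ↔ ∀ {X : R} (c : C.toQCat.obj X), L.IsAbsoluteColimit c := by
  obtain ⟨D, hD⟩ := D
  obtain ⟨C, hC⟩ := C
  constructor
  · intro h X c
    let G : QFunctor C (Presheaf.module C).toQCat :=
      { map := fun {X} c =>
          ({ app := fun b => sSup {f | ∃ i : Σ Y : R, D.obj Y,
              f = C.hom (L.map i.2) c ≫ C.hom b (L.map i.2)}
             app_le := fun b b' => by
              rw [Quantaloid.sSup_comp]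
              refine sSup_le ?_
              rintro _ ⟨_, ⟨i, rfl⟩, rfl⟩
              refine le_trans ?_ (le_sSup ⟨i, rfl⟩)
              change (C.hom (L.map i.2) c ≫ C.hom b' (L.map i.2)) ≫ C.hom b b' ≤ _
              rw [Category.assoc]
              exact Quantaloid.comp_mono le_rfl (C.comp_le _ _ _) } : Presheaf C X)
        hom_le := fun {X' X} c' c => by
          refine Mod.le_res_iff.2 fun Y b => ?_
          change C.hom c' c ≫ sSup _ ≤ sSup _
          rw [Quantaloid.comp_sSup]
          refine sSup_le ?_
          rintro _ ⟨_, ⟨i, rfl⟩, rfl⟩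
          refine le_trans ?_ (le_sSup ⟨i, rfl⟩)
          change C.hom c' c ≫ C.hom (L.map i.2) c' ≫ C.hom b (L.map i.2) ≤ _
          rw [← Category.assoc]
          exact Quantaloid.comp_mono (C.comp_le _ _ _) le_rfl }
    have hG := h (Z := of (Presheaf.module C).toCauchyCat)
      (mk (A := ⟨C, hC⟩) (B := (Presheaf.module C).toCauchyCat) (Presheaf.yoneda C))
      (mk (A := ⟨C, hC⟩) (B := (Presheaf.module C).toCauchyCat) G) (by
        change LE.le (α := QFunctor D _) (L.comp (Presheaf.yoneda C)) (L.comp G)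
        intro Y d
        refine le_trans ?_ (Presheaf.res_repr (A := C) (L.map d) (G.map (L.map d))).ge
        exact L.isAbsoluteColimit_map d)
    exact (mk_le.1 hG X c).trans (Presheaf.res_repr (A := C) c (G.map c)).le
  · rintro h ⟨Z⟩ F G hFG
    obtain ⟨F, rfl⟩ := exists_mk F
    obtain ⟨G, rfl⟩ := exists_mk G
    intro X c
    refine (h c).trans (sSup_le ?_)
    rintro _ ⟨⟨Y, d⟩, rfl⟩
    refine (Quantaloid.comp_mono (G.hom_le _ _) (F.hom_le _ _)).trans ?_
    exact (Quantaloid.comp_mono le_rfl (Z.toQCat.hom_le_hom_right _ (hFG Y d))).trans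
      (Z.toQCat.comp_le _ _ _)

/-- Given the lifting property, lift the identity of `X` against the corestriction of `J` to its
absolute image; the retraction obtained forces full faithfulness. Conversely, `V c` is an absolute
colimit of objects `J (U d)`. By full faithfulness the weight lives on `X`, whose Cauchy
completeness supplies an object `w` with `J w ≅ V c`. -/
theorem embedding_mk_iff {X Y : CauchyCat R} {J : QFunctor X.toQCat Y.toQCat} :
    Embedding (mk J) ↔ J.FullyFaithful := by
  constructor
  · intro h
    let I : CauchyCat R := ⟨J.absoluteImage, J.cauchyComplete_absoluteImage Y.cauchyComplete⟩
    let L : QFunctor X.toQCat I.toQCat :=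
      { map := fun x => ⟨J.map x, J.isAbsoluteColimit_map x⟩, hom_le := fun x' x => J.hom_le x' x }
    let V : QFunctor I.toQCat Y.toQCat := { map := fun y => y.1, hom_le := fun _ _ => le_rfl }
    obtain ⟨W, h₁, -⟩ := h (mk L) (laxEpi_mk_iff.2 fun c => c.2) (𝟙 _) (mk V)
      ((Category.id_comp _).trans rfl)
    obtain ⟨W, rfl⟩ := exists_mk W
    obtain ⟨h₁, h₂⟩ := mk_eq.1 (h₁ : mk (L.comp W) = mk (QFunctor.id _))
    intro Z Z' x' x
    refine (W.hom_le (L.map x') (L.map x)).trans ?_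
    exact (X.toQCat.hom_le_hom_right _ (h₁ _ x)).trans (X.toQCat.hom_le_hom_left _ (h₂ _ x'))
  · rintro hJ ⟨D⟩ ⟨C⟩ L hL U V hUV
    obtain ⟨L, rfl⟩ := exists_mk L
    obtain ⟨U, rfl⟩ := exists_mk U
    obtain ⟨V, rfl⟩ := exists_mk V
    obtain ⟨hUV, hVU⟩ := mk_eq.1 (hUV : mk (U.comp J) = mk (L.comp V))
    rw [laxEpi_mk_iff] at hL
    let B := Y.toQCat
    have key : ∀ (T : R) (c : C.toQCat.obj T), ∃ w : X.toQCat.obj T,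
        𝟙 T ≤ B.hom (J.map w) (V.map c) ∧ 𝟙 T ≤ B.hom (V.map c) (J.map w) := by
      intro T c
      have hu : 𝟙 T ≤ sSup {f | ∃ i : Σ S : R, D.toQCat.obj S,
          f = B.hom (J.map (U.map i.2)) (V.map c) ≫ B.hom (V.map c) (J.map (U.map i.2))} := by
        refine (hL c).trans (sSup_le ?_)
        rintro _ ⟨i, rfl⟩
        refine le_trans ?_ (le_sSup ⟨i, rfl⟩)
        exact Quantaloid.comp_mono ((V.hom_le _ _).trans (B.hom_le_hom_left _ (hUV _ i.2)))
          ((V.hom_le _ _).trans (B.hom_le_hom_right _ (hVU _ i.2)))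
      obtain ⟨w, hl, hr⟩ := X.cauchyComplete.exists_of_family (ι := Σ S : R, D.toQCat.obj S)
        (fun i => U.map i.2) (fun i => B.hom (J.map (U.map i.2)) (V.map c))
        (fun i => B.hom (V.map c) (J.map (U.map i.2))) hu
        (fun i j => (B.comp_le _ _ _).trans (hJ _ _))
      refine ⟨w, hu.trans (sSup_le ?_), hu.trans (sSup_le ?_)⟩
      · rintro _ ⟨i, rfl⟩
        exact (Quantaloid.comp_mono le_rfl ((hr i).trans (J.hom_le _ _))).trans (B.comp_le _ _ _)
      · rintro _ ⟨i, rfl⟩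
        exact (Quantaloid.comp_mono ((hl i).trans (J.hom_le _ _)) le_rfl).trans (B.comp_le _ _ _)
    choose W hW hW' using key
    let W' : QFunctor C.toQCat X.toQCat :=
      { map := fun c => W _ c
        hom_le := fun c' c => (V.hom_le c' c).trans (((B.hom_le_hom_right _ (hW' _ c)).trans
          (B.hom_le_hom_left _ (hW _ c'))).trans (hJ _ _)) }
    refine ⟨mk W', mk_eq.2 ⟨fun T d => ?_, fun T d => ?_⟩, mk_eq.2 ⟨hW, hW'⟩⟩
    · exact ((hW T (L.map d)).trans (B.hom_le_hom_right _ (hVU T d))).trans (hJ _ _)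
    · exact ((hW' T (L.map d)).trans (B.hom_le_hom_left _ (hUV T d))).trans (hJ _ _)

end OrdCat

/-! ### Modules are the injective Cauchy complete categories -/

namespace Mod

variable {R : Type u} [SmallCategory R] [Quantaloid R]

/-- The component of a module homomorphism. -/
def homFn {M N : Mod R} (f : M ⟶ N) (X : R) : sSupHom (M.elems X) (N.elems X) :=
  SupLat.fn (QHom.app f (op X))

theorem homFn_act {M N : Mod R} (f : M ⟶ N) {X Y : R} (m : M.elems Y) (g : X ⟶ Y) :
    homFn f X (act m g) = act (homFn f Y m) g :=
  congrArg (fun k : M.obj (op Y) ⟶ N.obj (op X) => SupLat.fn k m) (NatTrans.naturality f g.op)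

/-- The functor underlying a module homomorphism. -/
def homFunctor {M N : Mod R} (f : M ⟶ N) : QFunctor M.toQCat N.toQCat :=
  qfunctorOfActLe (fun X => homFn f X) (fun X => OrderHomClass.mono (homFn f X))
    (fun m g => (homFn_act f m g).ge)

/-- The functor sending a module to its category of elements. -/
def toOrdCat (R : Type u) [SmallCategory R] [Quantaloid R] : Mod R ⥤ OrdCat R where
  obj M := .of M.toCauchyCat
  map {M N} f := OrdCat.mk (A := M.toCauchyCat) (B := N.toCauchyCat) (homFunctor f)
  map_id _ := rfl
  map_comp _ _ := rfl

/-- The fibrewise right adjoints of the sup-preserving maps commute with the actions only laxly,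
which is all a functor needs. -/
theorem leftAdj_mk_homFunctor {M N : Mod R} (f : M ⟶ N) :
    LeftAdj (OrdCat.mk (A := M.toCauchyCat) (B := N.toCauchyCat) (homFunctor f)) := by
  let G : QFunctor N.toQCat M.toQCat := qfunctorOfActLe
    (fun X n => sSup {m | homFn f X m ≤ n})
    (fun X n n' h => sSup_le_sSup fun m hm => le_trans hm h)
    (fun {X Y} n g => le_sSup (by
      change homFn f X (act _ g) ≤ _
      rw [homFn_act, map_sSup]
      refine act_mono (sSup_le ?_) le_rfl
      rintro _ ⟨m, hm, rfl⟩
      exact hm))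
  refine ⟨OrdCat.mk (A := N.toCauchyCat) (B := M.toCauchyCat) G, ?_, ?_⟩
  · refine OrdCat.mk_le.2 (qfunctor_le_iff.2 fun {X} m => ?_)
    exact le_sSup (a := m) (s := {m' | homFn f X m' ≤ homFn f X m}) le_rfl
  · refine OrdCat.mk_le.2 (qfunctor_le_iff.2 fun {X} n => ?_)
    change homFn f X (sSup {m | homFn f X m ≤ n}) ≤ n
    rw [map_sSup]
    refine sSup_le ?_
    rintro _ ⟨m, hm, rfl⟩
    exact hm

/-- Any functor is laxly compatible with the actions. Transposing the lax inequality for `G` gives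
the reverse inequality for `F`, so `F` is strictly compatible; it preserves joins as a lower
adjoint. -/
theorem exists_homFunctor_of_adjoint {M N : Mod R} (F : QFunctor M.toQCat N.toQCat)
    (G : QFunctor N.toQCat M.toQCat) (h : QFunctor.id _ ≤ F.comp G) (h' : G.comp F ≤ QFunctor.id _) :
    ∃ f : M ⟶ N, homFunctor f = F := by
  have gc : ∀ (X : R), GaloisConnection (α := M.elems X) (β := N.elems X) F.map G.map :=
    fun X m n => ⟨fun hm => (qfunctor_le_iff.1 h (X := X) m).trans (qfunctor_mono G hm),
      fun hn => (qfunctor_mono F hn).trans (qfunctor_le_iff.1 h' (X := X) n)⟩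
  let φ : ∀ X : R, sSupHom (M.elems X) (N.elems X) := fun X =>
    { toFun := F.map
      map_sSup' := fun S => ((gc X).l_sSup).trans sSup_image.symm }
  refine ⟨{ app := fun X => φ X.unop, naturality := fun X Y g => ?_ }, rfl⟩
  refine sSupHom.ext fun m => ?_
  change φ Y.unop (act m g.unop) = act (φ X.unop m) g.unop
  refine le_antisymm (((gc _) _ _).2 ?_) (qfunctor_act_le F m g.unop)
  refine le_trans (act_mono ((gc _).le_u_l m) le_rfl) ?_
  exact qfunctor_act_le G _ _

theorem leftAdj_iff {M N : Mod R} (F : (toOrdCat R).obj M ⟶ (toOrdCat R).obj N) :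
    LeftAdj F ↔ ∃ f, (toOrdCat R).map f = F := by
  constructor
  · obtain ⟨F, rfl⟩ := OrdCat.exists_mk F
    rintro ⟨G, h, h'⟩
    obtain ⟨G, rfl⟩ := OrdCat.exists_mk G
    obtain ⟨f, rfl⟩ := exists_homFunctor_of_adjoint F G h h'
    exact ⟨f, rfl⟩
  · rintro ⟨f, rfl⟩
    exact leftAdj_mk_homFunctor f

theorem toOrdCat_map_le_iff {M N : Mod R} (f g : M ⟶ N) :
    (toOrdCat R).map f ≤ (toOrdCat R).map g ↔ f ≤ g :=
  (OrdCat.mk_le.trans qfunctor_le_iff).trans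
    ⟨fun h X x => h (X := X.unop) x, fun h X x => h (op X) x⟩

/-- The extension is the left Kan extension along `J`, computed with joins and the action of `M`;
full faithfulness of `J` makes it restrict to `F`. -/
theorem embeddingInjective_toOrdCat (M : Mod R) : EmbeddingInjective ((toOrdCat R).obj M) := by
  rintro ⟨X⟩ ⟨Y⟩ J hJ F
  obtain ⟨J, rfl⟩ := OrdCat.exists_mk J
  obtain ⟨F, rfl⟩ := OrdCat.exists_mk F
  rw [OrdCat.embedding_mk_iff] at hJ
  let G : QFunctor Y.toQCat M.toQCat :=
    { map := fun {S} y => (sSup {m | ∃ i : Σ T : R, X.toQCat.obj T,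
        m = act (M := M) (F.map i.2) (Y.toQCat.hom (J.map i.2) y)} : M.elems S)
      hom_le := fun {S' S} y' y => by
        refine le_res_iff.2 ?_
        rw [sSup_act]
        refine sSup_le ?_
        rintro _ ⟨_, ⟨i, rfl⟩, rfl⟩
        refine le_trans ?_ (le_sSup ⟨i, rfl⟩)
        refine (act_comp (M := M) (F.map i.2) _ _).ge.trans ?_
        exact act_mono le_rfl (Y.toQCat.comp_le _ _ _) }
  refine ⟨OrdCat.mk (B := M.toCauchyCat) G, OrdCat.mk_eq.2 ⟨?_, ?_⟩⟩
  · refine qfunctor_le_iff.2 fun {S} x => sSup_le ?_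
    rintro _ ⟨i, rfl⟩
    exact le_res_iff.1 ((hJ _ _).trans (F.hom_le _ _))
  · refine qfunctor_le_iff.2 fun {S} x => ?_
    refine le_trans ?_ (le_sSup (a := act (M := M) (F.map x) (Y.toQCat.hom (J.map x) (J.map x)))
      ⟨⟨S, x⟩, rfl⟩)
    conv_lhs => rw [← act_id (M := M) (F.map x)]
    exact act_mono le_rfl (Y.toQCat.id_le _)

/-! ### Quotients of modules by nuclei -/

/-- A closure operator on a module that is compatible with the action. -/
structure Nucleus (M : Mod R) where
  closure : ∀ X : R, ClosureOperator (M.elems X)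
  act_le : ∀ {X Y : R} (m : M.elems Y) (f : X ⟶ Y),
    act (closure Y m) f ≤ closure X (act m f)

namespace Nucleus

variable {M : Mod R} (j : Nucleus M)

instance instCompleteLattice (X : R) : CompleteLattice (j.closure X).Closeds :=
  (j.closure X).gi.liftCompleteLattice

theorem toCloseds_act {X Y : R} (m : M.elems Y) (f : X ⟶ Y) :
    (j.closure X).toCloseds (act ((j.closure Y).toCloseds m).1 f) =
      (j.closure X).toCloseds (act m f) := by
  refine le_antisymm ?_ ?_
  · exact ((j.closure X).gi.gc.l_le (j.act_le m f))
  · exact (j.closure X).gi.gc.monotone_l (act_mono ((j.closure Y).le_closure m) le_rfl)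

/-- The action of an arrow on closed elements. -/
def actHom {X Y : R} (f : X ⟶ Y) : sSupHom (j.closure Y).Closeds (j.closure X).Closeds where
  toFun m := (j.closure X).toCloseds (act m.1 f)
  map_sSup' S := by
    change (j.closure X).toCloseds (act ((j.closure Y).toCloseds (sSup (Subtype.val '' S))).1 f) = _
    rw [toCloseds_act, sSup_act, (j.closure X).gi.gc.l_sSup, iSup_image, iSup_image, sSup_image]

/-- The module of closed elements. -/
def quotient : Mod R where
  obj X := ⟨(j.closure X.unop).Closeds⟩
  map {X Y} f := j.actHom f.unop
  map_id X := by
    refine sSupHom.ext fun m => Subtype.ext ?_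
    change j.closure X.unop (act m.1 (𝟙 _)) = m.1
    rw [act_id]
    exact m.2.closure_eq
  map_comp {X Y Z} f g := by
    refine sSupHom.ext fun m => ?_
    change (j.closure Z.unop).toCloseds (act m.1 (g.unop ≫ f.unop)) = (j.closure Z.unop).toCloseds
      (act ((j.closure Y.unop).toCloseds (act m.1 f.unop)).1 g.unop)
    rw [toCloseds_act, act_comp]
  preservesSups {X Y} S := by
    refine sSupHom.ext fun m => ?_
    change (j.closure Y.unop).toCloseds (act m.1 (sSup (Quiver.Hom.unop '' S))) =
      (⨆ g ∈ _, _ : (j.closure Y.unop).Closeds)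
    rw [act_sSup, (j.closure Y.unop).gi.gc.l_sSup, iSup_image, iSup_image, iSup_image]
    rfl

/-- The closure of an element lies below a closed `m` exactly when the element does, so closed
elements form a full subcategory. -/
theorem res_quotient {X Y : R} (m' : j.quotient.elems Y) (m : j.quotient.elems X) :
    res m' m = res (M := M) m'.1 m.1 := by
  refine eq_of_forall_le_iff fun f => ?_
  rw [le_res_iff, le_res_iff]
  exact (j.closure X).gi.gc (act m'.1 f) m

end Nucleus

theorem fullyFaithful_yoneda (A : QCat R) : (Presheaf.yoneda A).FullyFaithful := fun a' a =>
  (Presheaf.res_repr a' (Presheaf.repr a)).le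

/-- Injectivity against the Yoneda embedding gives a retraction `r` from presheaves. The composite
of `r` with Yoneda is a nucleus on the presheaf module, and its closed elements are the
representables up to isomorphism in `A`. -/
theorem exists_iso_of_embeddingInjective {A : OrdCat R} (hA : EmbeddingInjective A) :
    ∃ M : Mod R, Nonempty ((toOrdCat R).obj M ≅ A) := by
  obtain ⟨A⟩ := A
  let 𝔸 := A.toQCat
  let P : Mod R := Presheaf.module 𝔸
  obtain ⟨r, hr⟩ := hA (OrdCat.mk (A := A) (B := P.toCauchyCat) (Presheaf.yoneda 𝔸))
    (OrdCat.embedding_mk_iff.2 (fullyFaithful_yoneda 𝔸)) (𝟙 _)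
  obtain ⟨r, rfl⟩ := OrdCat.exists_mk r
  obtain ⟨h₁, h₂⟩ := OrdCat.mk_eq.1 (hr : OrdCat.mk ((Presheaf.yoneda 𝔸).comp r) =
    OrdCat.mk (QFunctor.id 𝔸))
  let e : QFunctor P.toQCat P.toQCat := QFunctor.comp r (Presheaf.yoneda 𝔸)
  have hY : ∀ {X : R} (a : 𝔸.obj X), LE.le (α := P.elems X) (e.map (Presheaf.repr a))
      (Presheaf.repr a) ∧ LE.le (α := P.elems X) (Presheaf.repr a) (e.map (Presheaf.repr a)) :=
    fun {X} a => ⟨one_le_res_iff.1 ((h₁ X a).trans ((Presheaf.yoneda 𝔸).hom_le _ _)),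
      one_le_res_iff.1 ((h₂ X a).trans ((Presheaf.yoneda 𝔸).hom_le _ _))⟩
  let j : Nucleus P :=
    { closure := fun X =>
        { toFun := fun φ => e.map φ
          monotone' := fun _ _ h => qfunctor_mono e h
          -- No adjunction is assumed: by Yoneda `φ(a)` is the hom from `repr a` to `φ`, which `r`
          -- sends below the hom from `r (repr a) ≅ a` to `r φ`.
          le_closure' := fun φ Y a => (Presheaf.res_repr a φ).ge.trans ((r.hom_le _ _).trans
            (𝔸.hom_le_hom_left _ (h₂ Y a)))
          idempotent' := fun φ => le_antisymm (hY _).1 (hY _).2 }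
      act_le := fun m f => qfunctor_act_le e m f }
  let F : QFunctor j.quotient.toQCat 𝔸 :=
    { map := fun φ => r.map φ.1
      hom_le := fun φ' φ => (j.res_quotient φ' φ).le.trans (r.hom_le _ _) }
  let g : ∀ (X : R), 𝔸.obj X → j.quotient.elems X := fun X a =>
    ⟨Presheaf.repr a, (j.closure X).isClosed_iff.2 (le_antisymm (hY a).1 (hY a).2)⟩
  let G : QFunctor 𝔸 j.quotient.toQCat :=
    { map := fun a => g _ a
      hom_le := fun a' a => ((Presheaf.yoneda 𝔸).hom_le a' a).trans
        (j.res_quotient (g _ a') (g _ a)).ge }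
  refine ⟨j.quotient, ⟨⟨OrdCat.mk (A := j.quotient.toCauchyCat) (B := A) F,
    OrdCat.mk (A := A) (B := j.quotient.toCauchyCat) G, OrdCat.mk_eq.2 ⟨?_, ?_⟩,
    OrdCat.mk_eq.2 ⟨h₁, h₂⟩⟩⟩⟩
  · exact qfunctor_le_iff.2 fun φ => φ.2.closure_eq.le
  · exact qfunctor_le_iff.2 fun φ => φ.2.closure_eq.ge

/-- Modules and their homomorphisms are the injective Cauchy complete categories and the
left adjoint functors. -/
theorem injectiveModel_toOrdCat : InjectiveModel (toOrdCat R) where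
  le_iff := toOrdCat_map_le_iff
  leftAdj_iff := leftAdj_iff
  injective_iff _ := ⟨exists_iso_of_embeddingInjective,
    fun ⟨M, ⟨e⟩⟩ => (embeddingInjective_toOrdCat M).of_iso e⟩

end Mod

/-! ### Composition of homomorphisms and equivalences -/

section Composition

variable {C : Type u₁} [Category.{v₁} C] [Quantaloid C] {D : Type u₂} [Category.{v₂} D] [Quantaloid D]
  {E : Type u} [Category.{v} E] [Quantaloid E]

theorem PreservesSups.comp {F : C ⥤ D} {G : D ⥤ E} (hF : PreservesSups F) (hG : PreservesSups G) :
    PreservesSups (F ⋙ G) := by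
  intro X Y S
  rw [Functor.comp_map, hF, hG, Set.image_image]
  rfl

/-- Composition of equivalences of quantaloids. -/
def QEquiv.trans (e : QEquiv C D) (e' : QEquiv D E) : QEquiv C E where
  functor := ⟨e.functor.toFunctor ⋙ e'.functor.toFunctor,
    PreservesSups.comp e.functor.preservesSups e'.functor.preservesSups⟩
  inverse := ⟨e'.inverse.toFunctor ⋙ e.inverse.toFunctor,
    PreservesSups.comp e'.inverse.preservesSups e.inverse.preservesSups⟩
  unitIso := e.unitIso ≪≫ Functor.isoWhiskerLeft e.functor.toFunctor
    (Functor.isoWhiskerRight e'.unitIso e.inverse.toFunctor)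
  counitIso := Functor.isoWhiskerLeft e'.inverse.toFunctor
    (Functor.isoWhiskerRight e.counitIso e'.functor.toFunctor) ≪≫ e'.counitIso

/-- The inverse of an equivalence of quantaloids. -/
def QEquiv.symm (e : QEquiv C D) : QEquiv D C where
  functor := e.inverse
  inverse := e.functor
  unitIso := e.counitIso.symm
  counitIso := e.unitIso.symm

theorem PreservesSups.op {F : C ⥤ D} (hF : PreservesSups F) : PreservesSups F.op := by
  intro X Y S
  apply Quiver.Hom.unop_inj
  change F.map (sSup (Quiver.Hom.unop '' S)) = sSup (Quiver.Hom.unop '' ((fun f => F.op.map f) '' S))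
  rw [hF, Set.image_image, Set.image_image]
  rfl

end Composition

/-! ### Modules on the split-idempotent completion -/

namespace Mod

variable {Q : Type u} [SmallCategory Q] [Quantaloid Q]

/-- Constructor for module homomorphisms. -/
def homMk {M N : Mod Q} (φ : ∀ X : Q, sSupHom (M.elems X) (N.elems X))
    (h : ∀ {X Y : Q} (m : M.elems Y) (g : X ⟶ Y), φ X (act m g) = act (φ Y m) g) : M ⟶ N where
  app X := φ X.unop
  naturality _ _ g := sSupHom.ext fun m => h m g.unop

theorem hom_ext_fn {M N : Mod Q} {f g : M ⟶ N} (h : ∀ (X : Q) (m : M.elems X),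
    homFn f X m = homFn g X m) : f = g :=
  QHom.hom_ext fun X => SupLat.hom_ext fun m => h X.unop m

theorem homFn_comp {M N P : Mod Q} (f : M ⟶ N) (g : N ⟶ P) (X : Q) (m : M.elems X) :
    homFn (f ≫ g) X m = homFn g X (homFn f X m) := rfl

/-- The action of an arrow as a morphism of suplattices. -/
def actSup (M : Mod Q) {X Y : Q} (f : X ⟶ Y) : sSupHom (M.elems Y) (M.elems X) :=
  SupLat.fn (M.map f.op)

theorem preservesSups_toKaroubi : PreservesSups (Idempotents.toKaroubi Q) := by
  intro X Y S
  refine Idempotents.Karoubi.Hom.ext ?_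
  change sSup S = sSup ((fun b => b.f) '' ((fun f => (Idempotents.toKaroubi Q).map f) '' S))
  rw [Set.image_image]
  simp

variable (Q) in
/-- Restriction of modules along `Q ⟶ Idm(Q)`. -/
def restrict : Mod (Idm Q) ⥤ Mod Q where
  obj M := ⟨(Idempotents.toKaroubi Q).op ⋙ M.toFunctor,
    PreservesSups.comp (PreservesSups.op preservesSups_toKaroubi) M.preservesSups⟩
  map f := Functor.whiskerLeft (Idempotents.toKaroubi Q).op f
  map_id _ := rfl
  map_comp _ _ := rfl

theorem homFn_restrict {M N : Mod (Idm Q)} (f : M ⟶ N) (X : Q) :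
    homFn ((restrict Q).map f) X = homFn f ((Idempotents.toKaroubi Q).obj X) := rfl

/-- Every idempotent `P` is a retract of the identity on `P.X`, so a homomorphism is determined by
its components at identities. -/
theorem homFn_eq_restrict {M N : Mod (Idm Q)} (f : M ⟶ N) (P : Idm Q) (m : M.elems P) :
    homFn f P m = act (M := N) (homFn ((restrict Q).map f) P.X (act (M := M) m P.decompId_p)) P.decompId_i := by
  rw [homFn_restrict]
  refine Eq.trans ?_ (homFn_act f _ _)
  rw [← act_comp, ← Idempotents.Karoubi.decompId, act_id]

theorem restrict_map_le_iff {M N : Mod (Idm Q)} (f g : M ⟶ N) :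
    (restrict Q).map f ≤ (restrict Q).map g ↔ f ≤ g := by
  refine ⟨fun h X m => ?_, fun h X m => h _ m⟩
  change homFn f X.unop m ≤ homFn g X.unop m
  rw [homFn_eq_restrict, homFn_eq_restrict]
  exact act_mono (h (op X.unop.X) _) le_rfl

instance : (restrict Q).Faithful :=
  ⟨fun h => le_antisymm ((restrict_map_le_iff _ _).1 h.le) ((restrict_map_le_iff _ _).1 h.ge)⟩

instance : (restrict Q).Full where
  map_surjective {M N} f := by
    let K := Idempotents.toKaroubi Q
    let φ : ∀ X : Q, sSupHom (M.elems (K.obj X)) (N.elems (K.obj X)) := fun X => homFn f X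
    have hφ : ∀ {X Y : Q} (m : M.elems (K.obj Y)) (k : X ⟶ Y),
        φ X (act m (K.map k)) = act (φ Y m) (K.map k) := fun m k => homFn_act f m k
    refine ⟨homMk (fun P => (N.actSup P.decompId_i).comp ((φ P.X).comp
      (M.actSup P.decompId_p))) fun {P P'} m g => ?_, ?_⟩
    · let k : P.X ⟶ P'.X := g.f
      have h₁ : P.decompId_p ≫ g = K.map k ≫ P'.decompId_p := by
        ext; simp [k, K]
      have h₂ : P.decompId_i ≫ K.map k = g ≫ P'.decompId_i := by
        ext; simp [k, K]
      change act (φ P.X (act (act m g) P.decompId_p)) P.decompId_i =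
        act (act (φ P'.X (act m P'.decompId_p)) P'.decompId_i) g
      refine (congrArg (fun n => act (φ P.X n) P.decompId_i) ((act_comp m _ _).symm.trans
        ((congrArg (act m) h₁).trans (act_comp m _ _)))).trans ?_
      refine (congrArg (fun n => act n P.decompId_i) (hφ _ k)).trans ?_
      exact (act_comp _ _ _).symm.trans ((congrArg (act _) h₂).trans (act_comp _ _ _))
    · refine hom_ext_fn fun X m => ?_
      exact (act_id _).trans (congrArg (homFn f X) (act_id _))

/-! ### Extending a module to idempotents by taking fixed elements. -/

section Extension

variable (M : Mod Q)

/-- The elements of a module fixed by an idempotent. -/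
@[ext]
structure FixedElems (P : Idm Q) where
  val : M.elems P.X
  fixed : act val P.p = val

instance FixedElems.instCompleteLattice (P : Idm Q) : CompleteLattice (M.FixedElems P) :=
  letI : PartialOrder (M.FixedElems P) := PartialOrder.lift FixedElems.val fun _ _ => FixedElems.ext
  letI : SupSet (M.FixedElems P) := ⟨fun S => ⟨sSup (FixedElems.val '' S), by
    rw [sSup_act, Set.image_image]
    exact congrArg sSup (Set.image_congr fun m _ => m.fixed)⟩⟩
  completeLatticeOfSup (M.FixedElems P) fun S =>
    ⟨fun m hm => le_sSup (α := M.elems P.X) (Set.mem_image_of_mem FixedElems.val hm),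
      fun n hn => sSup_le (α := M.elems P.X) (a := n.val) (s := FixedElems.val '' S)
        (by rintro _ ⟨m, hm, rfl⟩; exact hn hm)⟩

theorem FixedElems.sSup_val {P : Idm Q} (S : Set (M.FixedElems P)) :
    (sSup S).val = sSup (FixedElems.val '' S) := rfl

/-- The action on fixed elements. -/
def fixedAct {P P' : Idm Q} (f : P ⟶ P') : sSupHom (M.FixedElems P') (M.FixedElems P) where
  toFun m := ⟨act m.val f.f, by rw [← act_comp, Idempotents.Karoubi.p_comp]⟩
  map_sSup' S := FixedElems.ext (by
    change act (sSup (FixedElems.val '' S)) f.f = sSup (FixedElems.val '' (_ '' S))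
    rw [sSup_act, Set.image_image, Set.image_image])

/-- The extension of a module to the split-idempotent completion. -/
def extend : Mod (Idm Q) where
  obj P := ⟨M.FixedElems P.unop⟩
  map f := M.fixedAct f.unop
  map_id P := sSupHom.ext fun m => FixedElems.ext m.fixed
  map_comp f g := sSupHom.ext fun m => FixedElems.ext (act_comp (FixedElems.val m) _ _)
  preservesSups {P P'} S := by
    refine sSupHom.ext fun m => FixedElems.ext ?_
    change act m.val (sSup (_ '' (_ '' S))) = (⨆ g ∈ _, _ : M.FixedElems P'.unop).val
    rw [act_sSup, iSup_image, ← sSup_image, FixedElems.sSup_val, Set.image_image, Set.image_image,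
      Set.image_image]
    rfl

/-- The restriction of the extension of a module. -/
def restrictExtendIso : (restrict Q).obj M.extend ≅ M where
  hom := homMk (fun X =>
    { toFun := FixedElems.val (M := M) (P := (Idempotents.toKaroubi Q).obj X)
      map_sSup' := fun S => rfl }) (fun m g => rfl)
  inv := homMk (fun X =>
    { toFun := fun m => (⟨m, act_id m⟩ : M.FixedElems ((Idempotents.toKaroubi Q).obj X))
      map_sSup' := fun S => FixedElems.ext (by
        refine Eq.trans ?_ (FixedElems.sSup_val M _).symm
        refine congrArg sSup (Eq.trans ?_ (Set.image_image _ _ _).symm)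
        exact (Set.image_id S).symm) }) (fun m g => rfl)
  hom_inv_id := rfl
  inv_hom_id := rfl

end Extension

instance : (restrict Q).EssSurj := ⟨fun M => ⟨M.extend, ⟨M.restrictExtendIso⟩⟩⟩

/-- Modules on a quantaloid are modules on its split-idempotent completion. -/
theorem nonempty_qEquiv_idm (Q : Type u) [SmallCategory Q] [Quantaloid Q] :
    Nonempty (QEquiv (Mod (Idm Q)) (Mod Q)) :=
  have : (restrict Q).IsEquivalence := { }
  QEquiv.nonempty_of_isEquivalence (restrict Q) restrict_map_le_iff

end Mod

/-- Biequivalent categories of ordered sheaves have equivalent modules. -/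
theorem nonempty_qEquiv_mod_of_biequivalence {Q Q' : Type u} [SmallCategory Q] [Quantaloid Q]
    [SmallCategory Q'] [Quantaloid Q'] (b : Biequivalence (Ord Q) (Ord Q')) :
    Nonempty (QEquiv (Mod Q) (Mod Q')) := by
  obtain ⟨Φ, _, hΦ⟩ := b.exists_homOrderEmbedding
  obtain ⟨e⟩ := (Mod.injectiveModel_toOrdCat.comp hΦ).nonempty_qEquiv
    (Mod.injectiveModel_toOrdCat (R := Idm Q'))
  obtain ⟨a⟩ := Mod.nonempty_qEquiv_idm Q
  obtain ⟨a'⟩ := Mod.nonempty_qEquiv_idm Q'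
  exact ⟨a.symm.trans (e.trans a')⟩

/-! ### The centre -/

section Homomorphisms

variable {C : Type u₁} [Category.{v₁} C] [Quantaloid C] {D : Type u₂} [Category.{v₂} D] [Quantaloid D]

/-- The order is encoded by the equation `f ⊔ g = g`, which `F` preserves and reflects. -/
theorem PreservesSups.map_le_map_iff {F : C ⥤ D} [F.Faithful] (hF : PreservesSups F) {X Y : C}
    {f g : X ⟶ Y} : F.map f ≤ F.map g ↔ f ≤ g := by
  have h := hF {f, g}
  rw [sSup_pair, Set.image_pair, sSup_pair] at h
  rw [← sup_eq_right, ← h, ← sup_eq_right]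
  exact ⟨fun h => F.map_injective h, fun h => congrArg F.map h⟩

theorem QEquiv.isEquivalence_functor (e : QEquiv C D) : e.functor.toFunctor.IsEquivalence :=
  (CategoryTheory.Equivalence.mk e.functor.toFunctor e.inverse.toFunctor e.unitIso
    e.counitIso).isEquivalence_functor

end Homomorphisms

namespace Centre

section Basic

variable {C : Type u₁} [Category.{v₁} C] [Quantaloid C]

/-- The component of an element of the centre. -/
def comp (α : Centre C) (X : C) : X ⟶ X := NatTrans.app (F := 𝟭 C) (G := 𝟭 C) α X

theorem comp_naturality (α : Centre C) {X Y : C} (f : X ⟶ Y) :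
    f ≫ α.comp Y = α.comp X ≫ f :=
  NatTrans.naturality (F := 𝟭 C) (G := 𝟭 C) α f

/-- Constructor for elements of the centre. -/
def mk (a : ∀ X : C, X ⟶ X) (h : ∀ {X Y : C} (f : X ⟶ Y), f ≫ a Y = a X ≫ f) : Centre C :=
  ({ app := a, naturality := fun _ _ f => h f } : 𝟭 C ⟶ 𝟭 C)

theorem comp_mk (a : ∀ X : C, X ⟶ X) (h : ∀ {X Y : C} (f : X ⟶ Y), f ≫ a Y = a X ≫ f) (X : C) :
    (mk a h).comp X = a X := rfl

theorem ext {α β : Centre C} (h : ∀ X, α.comp X = β.comp X) : α = β :=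
  QHom.hom_ext h

theorem le_iff {α β : Centre C} : α ≤ β ↔ ∀ X, α.comp X ≤ β.comp X := Iff.rfl

/-- Multiplication in `End` is composition in the other order; naturality of `β` at a component of
`α` swaps the factors. -/
theorem comp_mul (α β : Centre C) (X : C) : (α * β).comp X = α.comp X ≫ β.comp X :=
  Eq.trans (by rfl) (β.comp_naturality (α.comp X)).symm

/-- A surjective multiplicative order embedding of centres is an isomorphism. -/
theorem nonempty_orderMonoidIso {D : Type u₂} [Category.{v₂} D] [Quantaloid D]
    (φ : Centre C → Centre D) (hmul : ∀ α β, φ (α * β) = φ α * φ β)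
    (hle : ∀ α β, φ α ≤ φ β ↔ α ≤ β) (hsurj : Function.Surjective φ) :
    Nonempty (Centre C ≃*o Centre D) :=
  ⟨{ toEquiv := Equiv.ofBijective φ
      ⟨fun _ _ h => le_antisymm ((hle _ _).1 h.le) ((hle _ _).1 h.ge), hsurj⟩
     map_mul' := hmul
     map_le_map_iff' := hle _ _ }⟩

end Basic

theorem nonempty_orderMonoidIso_of_qEquiv {C : Type u₁} [Category.{v₁} C] [Quantaloid C]
    {D : Type u₂} [Category.{v₂} D] [Quantaloid D] (e : QEquiv C D) :
    Nonempty (Centre C ≃*o Centre D) := by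
  let F := e.functor.toFunctor
  let G := e.inverse.toFunctor
  have : F.IsEquivalence := e.isEquivalence_functor
  let ε : ∀ Y, F.obj (G.obj Y) ≅ Y := fun Y => e.counitIso.app Y
  have hε : ∀ {Y Y' : D} (f : Y ⟶ Y'), F.map (G.map f) ≫ (ε Y').hom = (ε Y).hom ≫ f :=
    fun f => e.counitIso.hom.naturality f
  have hε' : ∀ {Y Y' : D} (f : Y ⟶ Y'), f ≫ (ε Y').inv = (ε Y).inv ≫ F.map (G.map f) :=
    fun f => e.counitIso.inv.naturality f
  let η : ∀ X, X ≅ G.obj (F.obj X) := fun X => e.unitIso.app X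
  refine nonempty_orderMonoidIso (fun α =>
    mk (fun Y => (ε Y).inv ≫ F.map (α.comp (G.obj Y)) ≫ (ε Y).hom) fun {X Y} f => ?_) ?_ ?_ ?_
  · rw [← Category.assoc, hε', Category.assoc, Category.assoc, Category.assoc, ← hε,
      ← F.map_comp_assoc, α.comp_naturality, F.map_comp_assoc]
  · intro α β
    refine ext fun Y => ?_
    rw [comp_mul]
    simp only [comp_mk, comp_mul, F.map_comp, Category.assoc, Iso.hom_inv_id_assoc]
    rfl
  · intro α β
    rw [le_iff, le_iff]
    constructor
    · intro h X
      have h₁ := Quantaloid.comp_mono (Quantaloid.comp_mono (le_refl (ε (F.obj X)).hom) (h (F.obj X)))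
        (le_refl (ε (F.obj X)).inv)
      simp only [comp_mk, Category.assoc, Iso.hom_inv_id, Iso.hom_inv_id_assoc, Category.comp_id]
        at h₁
      rw [PreservesSups.map_le_map_iff e.functor.preservesSups] at h₁
      -- The inequality is known at `G (F X)`; naturality along the isomorphism `η X` moves it to
      -- `X`.
      have h₂ := Quantaloid.comp_mono (Quantaloid.comp_mono (le_refl (η X).hom) h₁)
        (le_refl (η X).inv)
      rwa [α.comp_naturality, β.comp_naturality, Category.assoc, Category.assoc, Iso.hom_inv_id,
        Category.comp_id, Category.comp_id] at h₂
    · intro h Y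
      exact Quantaloid.comp_mono le_rfl (Quantaloid.comp_mono
        ((PreservesSups.map_le_map_iff e.functor.preservesSups).2 (h _)) le_rfl)
  · intro β
    refine ⟨mk (fun X => F.preimage (β.comp (F.obj X))) fun f => F.map_injective (by
      simp [β.comp_naturality]), ext fun Y => ?_⟩
    change (ε Y).inv ≫ F.map (F.preimage (β.comp (F.obj (G.obj Y)))) ≫ (ε Y).hom = β.comp Y
    rw [F.map_preimage, ← β.comp_naturality, Iso.inv_hom_id_assoc]

end Centre

/-! ### The centre of the quantaloid of modules. -/

namespace Mod

variable {Q : Type u} [SmallCategory Q] [Quantaloid Q]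

/-- The module represented by an object. -/
def representable (X : Q) : Mod Q where
  obj Y := ⟨Y.unop ⟶ X⟩
  map {Y Z} f :=
    ({ toFun := fun g => f.unop ≫ g
       map_sSup' := fun S => Quantaloid.comp_sSup f.unop S } :
      sSupHom (Y.unop ⟶ X) (Z.unop ⟶ X))
  map_id Y := sSupHom.ext fun g => Category.id_comp (Y := X) g
  map_comp {Y Z W} f f' := sSupHom.ext fun g => Category.assoc (Z := X) f'.unop f.unop g
  preservesSups {Y Z} S := sSupHom.ext fun g => by
    change sSup _ ≫ _ = ⨆ k ∈ _, (_ : Z.unop ⟶ X)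
    rw [Quantaloid.sSup_comp, iSup_image, ← sSup_image, Set.image_image]
    rfl

/-- The homomorphism from a representable module given by an element. -/
def ofElem {M : Mod Q} {X : Q} (m : M.elems X) : representable X ⟶ M :=
  homMk (fun Y =>
    { toFun := fun g : Y ⟶ X => act m g
      map_sSup' := fun S => act_sSup m S }) fun g f => act_comp m f g

theorem act_representable {X Y Z : Q} (g : Y ⟶ X) (f : Z ⟶ Y) :
    act (M := representable X) g f = f ≫ g := rfl

/-- The action of the centre on modules. -/
def centreMap (α : Centre Q) : Centre (Mod Q) :=
  Centre.mk (fun M => homMk (fun X => M.actSup (α.comp X)) fun m g =>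
      (act_comp m _ _).symm.trans ((congrArg (act m) (α.comp_naturality g).symm).trans
        (act_comp m _ _)))
    fun f => hom_ext_fn fun X m => (homFn_act f m (α.comp X)).symm

theorem homFn_centreMap (α : Centre Q) (M : Mod Q) (X : Q) (m : M.elems X) :
    homFn ((centreMap α).comp M) X m = act m (α.comp X) := rfl

theorem nonempty_orderMonoidIso_centre (Q : Type u) [SmallCategory Q] [Quantaloid Q] :
    Nonempty (Centre Q ≃*o Centre (Mod Q)) := by
  refine Centre.nonempty_orderMonoidIso centreMap ?_ ?_ ?_
  · intro α β
    refine Centre.ext fun M => hom_ext_fn fun X m => ?_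
    rw [Centre.comp_mul, homFn_comp, homFn_centreMap, homFn_centreMap, homFn_centreMap,
      Centre.comp_mul, β.comp_naturality, act_comp]
  · intro α β
    constructor
    · intro h X
      have h₁ : act (M := representable X) (𝟙 X) (α.comp X) ≤
        act (M := representable X) (𝟙 X) (β.comp X) := h (representable X) (op X) (𝟙 X)
      rw [act_representable, act_representable, Category.comp_id, Category.comp_id] at h₁
      exact h₁
    · intro h M X m
      exact act_mono (le_refl m) (h X.unop)
  · intro β
    -- Yoneda: naturality of `β` along `ofElem m` forces it to act on `m` through `a X`. Naturality
    -- of `a` comes from computing `β` on `f` in two ways.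
    let a : ∀ X : Q, X ⟶ X := fun X => homFn (β.comp (representable X)) X (𝟙 X)
    have key : ∀ {M : Mod Q} {X : Q} (m : M.elems X), homFn (β.comp M) X m = act m (a X) := by
      intro M X m
      have h := congrArg (fun f => homFn f X (𝟙 X)) (β.comp_naturality (ofElem m))
      have h₁ : homFn (β.comp M) X (act m (𝟙 X)) = act m (a X) := h
      rwa [act_id] at h₁
    refine ⟨Centre.mk a fun {X Y} f => ?_, Centre.ext fun M => hom_ext_fn fun X m => (key m).symm⟩
    have h₁ : homFn (β.comp (representable Y)) X (f ≫ 𝟙 Y) = f ≫ a Y :=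
      homFn_act (β.comp (representable Y)) (𝟙 Y) f
    have h₂ : homFn (β.comp (representable Y)) X (f ≫ 𝟙 Y) = a X ≫ f ≫ 𝟙 Y :=
      key (M := representable Y) (f ≫ 𝟙 Y)
    rw [← h₁, h₂, Category.comp_id]

end Mod

/-- Morita equivalent quantaloids have isomorphic centres. -/
theorem nonempty_orderMonoidIso_centre_of_qEquiv_mod {Q Q' : Type u} [SmallCategory Q] [Quantaloid Q]
    [SmallCategory Q'] [Quantaloid Q'] (e : QEquiv (Mod Q) (Mod Q')) :
    Nonempty (Centre Q ≃*o Centre Q') := by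
  obtain ⟨a⟩ := Mod.nonempty_orderMonoidIso_centre Q
  obtain ⟨b⟩ := Centre.nonempty_orderMonoidIso_of_qEquiv e
  obtain ⟨c⟩ := Mod.nonempty_orderMonoidIso_centre Q'
  exact ⟨(a.trans b).trans c.symm⟩

/-! ### Bicategorical constructions with thin hom-categories -/

namespace CauchyCat

variable {R : Type u} [SmallCategory R] [Quantaloid R]

/-- This disposes of every coherence law below: any two parallel 2-cells agree. -/
instance subsingleton_hom {A B : CauchyCat R} (F G : A ⟶ B) : Subsingleton (F ⟶ G) :=
  inferInstanceAs (Subsingleton (@Quiver.Hom (QFunctor A.toQCat B.toQCat) _ F G))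

/-- Functors that are isomorphic for the local preorder. -/
def isoOfLE {A B : CauchyCat R} {F G : A ⟶ B}
    (h : LE.le (α := QFunctor A.toQCat B.toQCat) F G)
    (h' : LE.le (α := QFunctor A.toQCat B.toQCat) G F) : F ≅ G where
  hom := homOfLE (X := QFunctor A.toQCat B.toQCat) h
  inv := homOfLE (X := QFunctor A.toQCat B.toQCat) h'
  hom_inv_id := Subsingleton.elim _ _
  inv_hom_id := Subsingleton.elim _ _

section

variable {B : Type u₁} [Bicategory.{w, v₁} B] {P P' : Pseudofunctor B (CauchyCat R)}

open scoped Pseudofunctor.StrongTrans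

/-- Strong transformations into `Cat_cc(R)` have no coherence conditions. -/
def strongTrans (f : ∀ A, P.obj A ⟶ P'.obj A)
    (nat : ∀ {A A' : B} (F : A ⟶ A'), P.map F ≫ f A' ≅ f A ≫ P'.map F) : P ⟶ P' where
  app := f
  naturality F := nat F
  naturality_naturality _ := Subsingleton.elim _ _
  naturality_id _ := Subsingleton.elim _ _
  naturality_comp _ _ := Subsingleton.elim _ _

/-- Modifications between transformations into `Cat_cc(R)` have no coherence conditions. -/
def modificationIso {α β : P ⟶ P'} (e : ∀ A, α.app A ≅ β.app A) : α ≅ β :=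
  Pseudofunctor.StrongTrans.isoMk e fun _ => Subsingleton.elim _ _

instance subsingleton_modification (α β : P ⟶ P') : Subsingleton (α ⟶ β) :=
  ⟨fun _ _ => Pseudofunctor.StrongTrans.homCategory.ext fun _ => Subsingleton.elim _ _⟩

/-- Equivalences of pseudofunctors, objectwise. -/
def equivalenceOfComponents (f : ∀ A, P.obj A ⟶ P'.obj A) (g : ∀ A, P'.obj A ⟶ P.obj A)
    (hf : ∀ {A A' : B} (F : A ⟶ A'), P.map F ≫ f A' ≅ f A ≫ P'.map F)
    (hg : ∀ {A A' : B} (F : A ⟶ A'), P'.map F ≫ g A' ≅ g A ≫ P.map F)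
    (unit : ∀ A, 𝟙 (P.obj A) ≅ f A ≫ g A) (counit : ∀ A, g A ≫ f A ≅ 𝟙 (P'.obj A)) :
    Bicategory.Equivalence P P' where
  hom := strongTrans f hf
  inv := strongTrans g hg
  unit := modificationIso unit
  counit := modificationIso counit
  left_triangle := Iso.ext (Subsingleton.elim _ _)

/-- The inverse of an equivalence of pseudofunctors. -/
def equivalenceSymm (e : Bicategory.Equivalence P P') : Bicategory.Equivalence P' P where
  hom := e.inv
  inv := e.hom
  unit := e.counit.symm
  counit := e.unit.symm
  left_triangle := Iso.ext (Subsingleton.elim _ _)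

end

end CauchyCat

/-! ### Change of base along a fully faithful homomorphism -/

section ChangeOfBase

variable {R : Type u} [SmallCategory R] [Quantaloid R] {R' : Type u} [SmallCategory R'] [Quantaloid R']

section Pullback

variable (G : QHom R' R) [G.toFunctor.Full] [G.toFunctor.Faithful]

theorem QHom.le_preimage_iff {X Y : R'} {f : X ⟶ Y} {g : G.obj X ⟶ G.obj Y} :
    f ≤ G.toFunctor.preimage g ↔ G.map f ≤ g := by
  rw [← PreservesSups.map_le_map_iff G.preservesSups, Functor.map_preimage]

/-- The pullback of an enriched category. -/
noncomputable def QCat.pullback (A : QCat R) : QCat R' where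
  obj X := A.obj (G.obj X)
  hom a' a := G.toFunctor.preimage (A.hom a' a)
  comp_le a'' a' a := by
    rw [QHom.le_preimage_iff, G.map_comp, Functor.map_preimage, Functor.map_preimage]
    exact A.comp_le _ _ _
  id_le a := by
    rw [QHom.le_preimage_iff, G.map_id]
    exact A.id_le _

theorem QCat.map_pullback_hom (A : QCat R) {X X' : R'} (a' : A.obj (G.obj X'))
    (a : A.obj (G.obj X)) :
    G.map ((A.pullback G).hom (X' := X') (X := X) a' a) = A.hom a' a :=
  Functor.map_preimage _ _

/-- The image of `P` under `G` is a weight only on objects of `A` whose type is some `G.obj Y`, so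
the colimit of a family is used rather than a presheaf on `A`. -/
theorem CauchyComplete.pullback {A : QCat R} (hA : CauchyComplete A) :
    CauchyComplete (A.pullback G) := by
  refine .of_representedBy fun X P => ?_
  obtain ⟨h, hl, hr⟩ := hA.exists_of_family (X := G.obj X) (ι := Σ Y : R', A.obj (G.obj Y))
    (t := fun i => G.obj i.1) (fun i => i.2) (fun i => G.map (P.left (Y := i.1) i.2))
    (fun i => G.map (P.right (Y := i.1) i.2)) (by
      have h := (PreservesSups.map_le_map_iff G.preservesSups).2 P.unit
      rw [G.map_id, G.preservesSups] at h
      refine h.trans (sSup_le_sSup ?_)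
      rintro _ ⟨_, ⟨Y, a, rfl⟩, rfl⟩
      exact ⟨⟨Y, a⟩, G.map_comp _ _⟩) (fun i j => by
      rw [← G.map_comp, ← QHom.le_preimage_iff]
      exact P.counit i.2 j.2)
  exact ⟨h, .of_le (fun {Y} b => (G.le_preimage_iff).2 (hl ⟨Y, b⟩))
    (fun {Y} b => (G.le_preimage_iff).2 (hr ⟨Y, b⟩))⟩

/-- The pullback of a functor. -/
noncomputable def QFunctor.pullback {A B : QCat R} (F : QFunctor A B) :
    QFunctor (A.pullback G) (B.pullback G) where
  map a := F.map a
  hom_le a' a := G.le_preimage_iff.2 ((A.map_pullback_hom G a' a).le.trans (F.hom_le _ _))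

theorem QFunctor.pullback_mono {A B : QCat R} {F F' : QFunctor A B} (h : F ≤ F') :
    F.pullback G ≤ F'.pullback G := fun X a =>
  G.le_preimage_iff.2 ((G.map_id X).le.trans (h _ a))

/-- Pullback as a pseudofunctor. -/
noncomputable def CauchyCat.pullback : Pseudofunctor (CauchyCat R) (CauchyCat R') where
  obj A := ⟨A.toQCat.pullback G, A.cauchyComplete.pullback G⟩
  map F := QFunctor.pullback G F
  map₂ {A B} _ _ η := homOfLE (X := QFunctor (A.toQCat.pullback G) (B.toQCat.pullback G)) (QFunctor.pullback_mono G (CauchyCat.nonempty_hom_iff.1 ⟨η⟩))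
  map₂_id _ := Subsingleton.elim _ _
  map₂_comp _ _ := Subsingleton.elim _ _
  mapId _ := Iso.refl _
  mapComp _ _ := Iso.refl _
  map₂_whisker_left _ _ _ _ := Subsingleton.elim _ _
  map₂_whisker_right _ _ := Subsingleton.elim _ _
  map₂_associator _ _ _ := Subsingleton.elim _ _
  map₂_left_unitor _ := Subsingleton.elim _ _
  map₂_right_unitor _ := Subsingleton.elim _ _

end Pullback

/-- The object `h` is obtained from `a` by transport along the isomorphism `θ` of types. -/
def QCat.IsShift {A : QCat R} {X Y : R} (θ : X ≅ Y) (a : A.obj Y) (h : A.obj X) : Prop :=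
  θ.hom ≤ A.hom a h ∧ θ.inv ≤ A.hom h a

namespace QCat.IsShift

variable {A : QCat R} {X Y : R} {θ : X ≅ Y} {a : A.obj Y} {h h' : A.obj X}

theorem symm (H : IsShift θ a h) : IsShift θ.symm h a := ⟨H.2, H.1⟩

/-- By symmetry in `h` and `h'`, shifts are unique up to isomorphism. -/
theorem one_le_hom (H : IsShift θ a h) (H' : IsShift θ a h') : 𝟙 X ≤ A.hom h h' := by
  rw [← θ.hom_inv_id]
  exact (Quantaloid.comp_mono H'.1 H.2).trans (A.comp_le _ _ _)

theorem map {B : QCat R} (F : QFunctor A B) (H : IsShift θ a h) :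
    IsShift θ (F.map a) (F.map h) :=
  ⟨H.1.trans (F.hom_le _ _), H.2.trans (F.hom_le _ _)⟩

theorem comp_hom_comp_le {X' Y' : R} {θ' : X' ≅ Y'} {b : A.obj Y'} {k : A.obj X'}
    (H : IsShift θ a h) (H' : IsShift θ' b k) : θ.hom ≫ A.hom b a ≫ θ'.inv ≤ A.hom k h :=
  (Quantaloid.comp_mono H.1 ((Quantaloid.comp_mono le_rfl H'.2).trans (A.comp_le _ _ _))).trans
    (A.comp_le _ _ _)

end QCat.IsShift

/-- An isomorphism with its inverse is an adjoint pair, hence an absolute weight on the single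
object `a`. -/
theorem CauchyComplete.exists_isShift {A : QCat R} (hA : CauchyComplete A) {X Y : R} (θ : X ≅ Y)
    (a : A.obj Y) : ∃ h : A.obj X, QCat.IsShift θ a h := by
  obtain ⟨h, hl, hr⟩ := hA.exists_of_family (ι := Unit) (t := fun _ => Y) (fun _ => a)
    (fun _ => θ.hom) (fun _ => θ.inv) (le_sSup ⟨(), θ.hom_inv_id.symm⟩)
    (fun _ _ => θ.inv_hom_id.le.trans (A.id_le a))
  exact ⟨h, hl (), hr ()⟩

open scoped Pseudofunctor.StrongTrans in
/-- Pulling back along mutually inverse equivalences is equivalent to the identity. -/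
theorem CauchyCat.nonempty_equivalence_pullback_comp (F : QHom R R') (G : QHom R' R)
    [F.toFunctor.Full] [F.toFunctor.Faithful] [G.toFunctor.Full] [G.toFunctor.Faithful]
    (θ : 𝟭 R ≅ F.toFunctor ⋙ G.toFunctor) :
    Nonempty (Bicategory.Equivalence (Pseudofunctor.id (CauchyCat R))
      ((CauchyCat.pullback G).comp (CauchyCat.pullback F))) := by
  let t : ∀ X : R, X ≅ G.obj (F.obj X) := fun X => θ.app X
  have ht : ∀ {X Y : R} (k : X ⟶ Y), (t X).inv ≫ k ≫ (t Y).hom = G.map (F.map k) :=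
    fun k => NatIso.naturality_1 θ k
  have ht' : ∀ {X Y : R} (k : X ⟶ Y), (t X).hom ≫ G.map (F.map k) ≫ (t Y).inv = k :=
    fun k => NatIso.naturality_2 θ k
  have hf : ∀ (A : CauchyCat R) (X : R) (a : A.toQCat.obj X),
      ∃ h : A.toQCat.obj (G.obj (F.obj X)), QCat.IsShift (t X).symm a h :=
    fun A X a => A.cauchyComplete.exists_isShift _ a
  have hg : ∀ (A : CauchyCat R) (X : R) (a : A.toQCat.obj (G.obj (F.obj X))),
      ∃ h : A.toQCat.obj X, QCat.IsShift (t X) a h :=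
    fun A X a => A.cauchyComplete.exists_isShift _ a
  have hp : ∀ (A : CauchyCat R) {X X' : R} (a' : A.toQCat.obj (G.obj (F.obj X')))
      (a : A.toQCat.obj (G.obj (F.obj X))), G.map (F.map (((A.toQCat.pullback G).pullback F).hom
        (X := X) (X' := X') a' a)) = A.toQCat.hom a' a := fun A X X' a' a =>
    (congrArg (fun k => G.map k) (QCat.map_pullback_hom F (A.toQCat.pullback G) (X := X) (X' := X')
      a' a)).trans (QCat.map_pullback_hom G A.toQCat (X := F.obj X) (X' := F.obj X') a' a)
  have hle : ∀ (A : CauchyCat R) {X X' : R} (a' : A.toQCat.obj (G.obj (F.obj X')))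
      (a : A.toQCat.obj (G.obj (F.obj X))) (k : X ⟶ X'),
      G.map (F.map k) ≤ A.toQCat.hom a' a →
      k ≤ ((A.toQCat.pullback G).pullback F).hom (X := X) (X' := X') a' a :=
    fun A X X' a' a k h => F.le_preimage_iff.2 (G.le_preimage_iff.2 h)
  have hle₁ : ∀ (A : CauchyCat R) {X : R} (a' a : A.toQCat.obj (G.obj (F.obj X))),
      𝟙 (G.obj (F.obj X)) ≤ A.toQCat.hom a' a →
      𝟙 X ≤ ((A.toQCat.pullback G).pullback F).hom (X := X) (X' := X) a' a :=
    fun A X a' a h => hle A a' a _ (by rwa [F.map_id, G.map_id])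
  -- The components shift each object along `t` or its inverse. Functors preserve shifts and shifts
  -- are unique up to isomorphism, which yields naturality, unit and counit.
  choose f hf using hf
  choose g hg using hg
  refine ⟨CauchyCat.equivalenceOfComponents (P := Pseudofunctor.id (CauchyCat R))
    (P' := (CauchyCat.pullback G).comp (CauchyCat.pullback F))
    (fun A => ({ map := fun a => f A _ a, hom_le := fun a' a => ?_ } :
      QFunctor A.toQCat ((A.toQCat.pullback G).pullback F)))
    (fun A => ({ map := fun {X} a => g A X a, hom_le := fun {X' X} a' a => ?_ } :
      QFunctor ((A.toQCat.pullback G).pullback F) A.toQCat))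
    (fun {A B} T => CauchyCat.isoOfLE ?_ ?_) (fun {A B} T => CauchyCat.isoOfLE ?_ ?_)
    (fun A => CauchyCat.isoOfLE ?_ ?_) (fun A => CauchyCat.isoOfLE ?_ ?_)⟩
  · refine hle A _ _ _ ?_
    rw [← ht]
    exact (hf A _ a).comp_hom_comp_le (hf A _ a')
  · refine (ht' _).ge.trans (le_trans ?_ ((hg A X a).comp_hom_comp_le (hg A X' a')))
    exact Quantaloid.comp_mono le_rfl (Quantaloid.comp_mono (hp A a' a).le le_rfl)
  · exact fun X a => hle₁ B _ _ ((hf B X (T.map a)).one_le_hom ((hf A X a).map T))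
  · exact fun X a => hle₁ B _ _ (((hf A X a).map T).one_le_hom (hf B X (T.map a)))
  · exact fun X a => (hg B X (T.map (X := G.obj (F.obj X)) a)).one_le_hom ((hg A X a).map T)
  · exact fun X a => ((hg A X a).map T).one_le_hom (hg B X (T.map (X := G.obj (F.obj X)) a))
  · exact fun X a => (hf A X a).symm.one_le_hom (hg A X (f A X a))
  · exact fun X a => (hg A X (f A X a)).one_le_hom (hf A X a).symm
  · exact fun X a => hle₁ A _ _ ((hf A X (g A X a)).one_le_hom (hg A X a).symm)
  · exact fun X a => hle₁ A _ _ ((hg A X a).symm.one_le_hom (hf A X (g A X a)))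

/-- Equivalent quantaloids have biequivalent categories of Cauchy complete categories. -/
theorem Biequivalence.nonempty_of_qEquiv (e : QEquiv R R') :
    Nonempty (Biequivalence (CauchyCat R) (CauchyCat R')) := by
  have : e.functor.toFunctor.IsEquivalence := e.isEquivalence_functor
  have : e.inverse.toFunctor.IsEquivalence := e.symm.isEquivalence_functor
  obtain ⟨unit⟩ := CauchyCat.nonempty_equivalence_pullback_comp e.functor e.inverse e.unitIso
  obtain ⟨counit⟩ := CauchyCat.nonempty_equivalence_pullback_comp e.inverse e.functor
    e.counitIso.symm
  -- Pullback is contravariant in the homomorphism, so the inverse of `e` induces the forward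
  -- pseudofunctor.
  exact ⟨⟨CauchyCat.pullback e.inverse, CauchyCat.pullback e.functor, unit,
    CauchyCat.equivalenceSymm counit⟩⟩

end ChangeOfBase

/-! ### Functoriality of the split-idempotent completion -/

section Idm

variable {C : Type u₁} [Category.{v₁} C] [Quantaloid C] {D : Type u₂} [Category.{v₂} D] [Quantaloid D]

/-- The homomorphism induced on split-idempotent completions. -/
def QHom.idm (F : QHom C D) : QHom (Idm C) (Idm D) where
  obj P := ⟨F.obj P.X, F.map P.p, by rw [← F.map_comp, P.idem]⟩
  map f := ⟨F.map f.f, by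
    change F.map _ ≫ F.map _ ≫ F.map _ = _
    rw [← F.map_comp, ← F.map_comp, f.comm]⟩
  map_id _ := rfl
  map_comp f g := Idempotents.Karoubi.Hom.ext (F.map_comp f.f g.f)
  preservesSups S := by
    refine Idempotents.Karoubi.Hom.ext ?_
    change F.map (sSup (_ '' S)) = sSup (_ '' (_ '' S))
    rw [F.preservesSups, Set.image_image, Set.image_image]

theorem QHom.isEquivalence_idm (F : QHom C D) [F.toFunctor.IsEquivalence] :
    F.idm.toFunctor.IsEquivalence where
  faithful := ⟨fun h => Idempotents.Karoubi.Hom.ext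
    (F.toFunctor.map_injective (congrArg Idempotents.Karoubi.Hom.f h))⟩
  full := ⟨fun {P P'} g => by
    obtain ⟨k, hk⟩ := F.toFunctor.map_surjective (X := P.X) (Y := P'.X) g.f
    refine ⟨⟨k, F.toFunctor.map_injective ?_⟩, Idempotents.Karoubi.Hom.ext hk⟩
    rw [F.map_comp, F.map_comp, hk]
    exact g.comm⟩
  essSurj := ⟨fun P => by
    let i := F.toFunctor.objObjPreimageIso P.X
    have hp : F.map (F.toFunctor.preimage (i.hom ≫ P.p ≫ i.inv)) = i.hom ≫ P.p ≫ i.inv :=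
      F.toFunctor.map_preimage _
    let P' : Idm C := ⟨F.toFunctor.objPreimage P.X, F.toFunctor.preimage (i.hom ≫ P.p ≫ i.inv),
      F.toFunctor.map_injective (by simp)⟩
    -- The arrow `i.hom` alone need not be fixed by the idempotents; composing with `P.p` makes it
    -- an arrow of `Idm D`, where `P.p` is the identity of `P`.
    refine ⟨P', ⟨⟨⟨i.hom ≫ P.p, ?_⟩, ⟨P.p ≫ i.inv, ?_⟩, ?_, ?_⟩⟩⟩
    · change F.map (F.toFunctor.preimage _) ≫ (i.hom ≫ P.p) ≫ P.p = i.hom ≫ P.p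
      rw [hp]
      simp
    · change P.p ≫ (P.p ≫ i.inv) ≫ F.map (F.toFunctor.preimage _) = P.p ≫ i.inv
      rw [hp]
      simp
    · refine Idempotents.Karoubi.Hom.ext ?_
      change (i.hom ≫ P.p) ≫ P.p ≫ i.inv = F.map (F.toFunctor.preimage _)
      rw [hp]
      simp
    · refine Idempotents.Karoubi.Hom.ext ?_
      change (P.p ≫ i.inv) ≫ i.hom ≫ P.p = P.p
      simp⟩

theorem QEquiv.nonempty_idm (e : QEquiv C D) : Nonempty (QEquiv (Idm C) (Idm D)) := by
  have : e.functor.toFunctor.IsEquivalence := e.isEquivalence_functor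
  have := e.functor.isEquivalence_idm
  exact QEquiv.nonempty_of_isEquivalence e.functor.idm.toFunctor
    fun f g => (PreservesSups.map_le_map_iff e.functor.idm.preservesSups)

end Idm

end QOrd

theorem proposition4p2 (Q Q' : Type u) [CategoryTheory.SmallCategory Q] [QOrd.Quantaloid Q]
    [CategoryTheory.SmallCategory Q'] [QOrd.Quantaloid Q'] :
    (Nonempty (QOrd.QEquiv Q Q') → Nonempty (QOrd.Biequivalence (QOrd.Ord Q) (QOrd.Ord Q'))) ∧
    (Nonempty (QOrd.Biequivalence (QOrd.Ord Q) (QOrd.Ord Q')) →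
      Nonempty (QOrd.QEquiv (QOrd.Mod Q) (QOrd.Mod Q'))) ∧
    (Nonempty (QOrd.QEquiv (QOrd.Mod Q) (QOrd.Mod Q')) →
      Nonempty (QOrd.Centre Q ≃*o QOrd.Centre Q')) := by
  refine ⟨fun ⟨e⟩ => ?_, fun ⟨b⟩ => QOrd.nonempty_qEquiv_mod_of_biequivalence b,
    fun ⟨e⟩ => QOrd.nonempty_orderMonoidIso_centre_of_qEquiv_mod e⟩
  obtain ⟨e'⟩ := e.nonempty_idm
  exact QOrd.Biequivalence.nonempty_of_qEquiv e'
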